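/- Fix $k\ge 1$. A $k$-partite vector is an element $\psi$ of some $\mathcal H_1\otimes\dots\otimes\mathcal H_k$ with finite-dimensional complex Hilbert spaces $\mathcal H_j$. For $k$-partite vectors $\psi\in\bigotimes_j\mathcal H_j$ and $\varphi\in\bigotimes_j\mathcal K_j$, the tensor product $\psi\otimes\varphi\in\bigotimes_j(\mathcal H_j\otimes\mathcal K_j)$ and the tensor sum $\psi\oplus\varphi\in\bigotimes_j(\mathcal H_j\oplus\mathcal K_j)$ are again $k$-partite vectors (likewise for finitely many summands). Let $\langle r\rangle=\sum_{a=1}^r|a\rangle\otimes\dots\otimes|a\rangle$ be the unnormalized $r$-level GHZ vector. All logarithms are to base $2$ and $h(t)=-t\log t-(1-t)\log(1-t)$. A remembering one-step LOCC channel sends $\rho\in\mathcal B(\bigotimes_j\mathcal H_j)\otimes\mathrm{Diag}(\mathbb C^{X})$ to $\sum_{y\in Y}\big((K_y)_i\otimes|y\rangle\langle f(y)|\big)\rho\big((K_y^*)_i\otimes|f(y)\rangle\langle y|\big)$, where $i$ is a party, $Y$ is a finite set, $f:Y\to X$ is a map, and the $K_y:\mathcal H_i\to\mathcal K_i$, acting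 at party $i$, satisfy $\sum_yK_y^*K_y\otimes|f(y)\rangle\langle f(y)|\le I$. An LOCC channel (possibly trace non-increasing) is a finite composition of such channels followed by discarding all or part of the information in the classical register. We write $\psi\xrightarrow{\mathrm{LOCC}}\varphi$ if some LOCC channel maps $|\psi\rangle\langle\psi|$ to $|\varphi\rangle\langle\varphi|$ (that is, it transforms $\psi/\|\psi\|$ into $\varphi/\|\varphi\|$ with success probability $\|\varphi\|^2/\|\psi\|^2$). Let $\Delta_{\log,k}$ be the set of logarithmic spectral points of the asymptotic spectrum of LOCC: the real-valued functionals $E$ on nonzero $k$-partite vectors for which there is an $\alpha\in[0,1)$ such that, for all nonzero $k$-partite vectors $\psi,\varphi$, all $p>0$ and all integers $r\ge1$, (S1) $E(\sqrt p\,\psi)=E(\psi)+\frac{\alpha}{1-\alpha}\log p$; (S2) $E(\langle r\rangle)=\frac1{1-\alpha}\log r$; (S3) $E(\psi\otimes\varphi)=E(\psi)+E(\varphi)$; (S4) $E(\psi\oplus\varphi)=\max_{t\in[0,1]}\big(tE(\psi)+(1-t)E(\varphi)+\frac1{1-\alpha}h(t)\big)$; (S5) $E(\psi)\ge E(\varphi)$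 whenever $\psi\xrightarrow{\mathrm{LOCC}}\varphi$. Let $\mathcal F_{\mathrm{sub},k}$ be the set of maps $E$ from the $k$-partite unit vectors to $\mathbb R_{\ge0}$ that are (a) subadditive: $E(\psi_1\otimes\psi_2)\le E(\psi_1)+E(\psi_2)$; (b) logarithmically bounded: $E(\psi_1\oplus\dots\oplus\psi_l)\le\max_{i}E(\psi_i/\|\psi_i\|)+\log l$ for all nonzero $k$-partite vectors $\psi_1,\dots,\psi_l$ such that $\psi_1\oplus\dots\oplus\psi_l$ is a unit vector; (c) monotone on average: if an LOCC channel maps $|\psi\rangle\langle\psi|$ to $\sum_{x\in X}P(x)|\psi_x\rangle\langle\psi_x|\otimes|x\rangle\langle x|$, where $X$ is a finite set, $P$ is a probability distribution on $X$ and $\psi$, $\psi_x$ are unit vectors, then $E(\psi)\ge\sum_{x\in X}P(x)E(\psi_x)$. Then for every $E\in\Delta_{\log,k}$ the restriction of $E$ to the $k$-partite unit vectors belongs to $\mathcal F_{\mathrm{sub},k}$. -/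

import Mathlib

noncomputable section

namespace LOCCSpectrum

/-! ### Multipartite vectors -/

/-- A `k`-partite Hilbert space `ℂ^{ι₁} ⊗ ⋯ ⊗ ℂ^{ι_k}`, given by the finite sets `ι_j` that label the
standard orthonormal bases of the local spaces `H_j = ℂ^{ι_j}`. -/
structure PartiteSpace (k : ℕ) where
  /-- the basis labels of each local space -/
  label : Fin k → Type
  /-- the local spaces are finite dimensional -/
  [fin : ∀ j, Fintype (label j)]

attribute [instance] PartiteSpace.fin

variable {k : ℕ}

/-- The labels of the product basis of a `k`-partite space. -/
abbrev PartiteSpace.Idx (V : PartiteSpace k) : Type := ∀ j, V.label j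

/-- A vector in some `k`-partite Hilbert space, through its coordinates in the product basis.
The norm of `vec` is the Hilbert space norm. -/
structure PartiteVec (k : ℕ) where
  /-- the `k`-partite space in which the vector lives -/
  space : PartiteSpace k
  /-- the vector itself -/
  vec : EuclideanSpace ℂ space.Idx

/-- The `k`-partite unit vectors, in all `k`-partite Hilbert spaces. -/
abbrev UnitPartiteVec (k : ℕ) : Type 1 := {ψ : PartiteVec k // ‖ψ.vec‖ = 1}

/-- The scalar multiple `c ψ`. -/
def PartiteVec.scale (c : ℝ) (ψ : PartiteVec k) : PartiteVec k :=
  ⟨ψ.space, (c : ℂ) • ψ.vec⟩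

/-- The `k`-partite space `(H₁ ⊗ K₁) ⊗ ⋯ ⊗ (H_k ⊗ K_k)`. -/
def PartiteSpace.tensor (V W : PartiteSpace k) : PartiteSpace k :=
  ⟨fun j => V.label j × W.label j⟩

/-- The tensor product `ψ ⊗ φ`, as a vector in `(H₁ ⊗ K₁) ⊗ ⋯ ⊗ (H_k ⊗ K_k)`. -/
def PartiteVec.tensor (ψ φ : PartiteVec k) : PartiteVec k where
  space := ψ.space.tensor φ.space
  vec := WithLp.toLp 2 fun x : (∀ j, ψ.space.label j × φ.space.label j) =>
    ψ.vec (fun j => (x j).1) * φ.vec (fun j => (x j).2)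

/-- The `k`-partite space `(H₁ ⊕ K₁) ⊗ ⋯ ⊗ (H_k ⊕ K_k)`. -/
def PartiteSpace.directSum (V W : PartiteSpace k) : PartiteSpace k :=
  ⟨fun j => V.label j ⊕ W.label j⟩

open Classical in
/-- The tensor sum `ψ ⊕ φ`, as a vector in `(H₁ ⊕ K₁) ⊗ ⋯ ⊗ (H_k ⊕ K_k)`: the image of `(ψ, φ)` under
the embedding that sends the basis vector `a` of `H₁ ⊗ ⋯ ⊗ H_k` to `(inl a₁, …, inl a_k)` and the
basis vector `b` of `K₁ ⊗ ⋯ ⊗ K_k` to `(inr b₁, …, inr b_k)`. -/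
def PartiteVec.directSum (ψ φ : PartiteVec k) : PartiteVec k where
  space := ψ.space.directSum φ.space
  vec := WithLp.toLp 2 fun x : (∀ j, ψ.space.label j ⊕ φ.space.label j) =>
    (∑ a : ψ.space.Idx, if x = (fun j => Sum.inl (a j)) then ψ.vec a else 0) +
    (∑ b : φ.space.Idx, if x = (fun j => Sum.inr (b j)) then φ.vec b else 0)

open Classical in
/-- The tensor sum `ψ₁ ⊕ ⋯ ⊕ ψ_l` of finitely many `k`-partite vectors, as a vector in the
`k`-partite space whose `j`-th local space is the direct sum of the `j`-th local spaces. -/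
def PartiteVec.bigSum {l : ℕ} (ψ : Fin l → PartiteVec k) : PartiteVec k where
  space := ⟨fun j => Σ i : Fin l, (ψ i).space.label j⟩
  vec := WithLp.toLp 2 fun x : (∀ j, Σ i : Fin l, (ψ i).space.label j) =>
    ∑ i : Fin l, ∑ a : (ψ i).space.Idx, if x = (fun j => ⟨i, a j⟩) then (ψ i).vec a else 0

/-- The unit tensor `⟨r⟩ = ∑_{a = 1}^r |a⟩ ⊗ ⋯ ⊗ |a⟩`, i.e. the unnormalized `r`-level GHZ vector. -/
def unitTensor (k r : ℕ) : PartiteVec k where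
  space := ⟨fun _ => Fin r⟩
  vec := WithLp.toLp 2 fun x : (Fin k → Fin r) => ∑ a : Fin r, if x = (fun _ => a) then 1 else 0

/-! ### LOCC channels -/

/-- Elements of `B(H₁) ⊗ ⋯ ⊗ B(H_k) ⊗ Diag(ℂ^X)`: operators with a classical register, as the family
of their diagonal blocks. -/
abbrev RegOp (V : PartiteSpace k) (X : Type) : Type := X → Matrix V.Idx V.Idx ℂ

open Classical in
/-- The operator `I ⊗ ⋯ ⊗ K ⊗ ⋯ ⊗ I` with `K : H_i → K_i` at party `i`. The equivalences `e` are the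
identification of the basis labels of the local spaces that do not change. -/
def localOp {V W : PartiteSpace k} (i : Fin k) (e : ∀ j, j ≠ i → V.label j ≃ W.label j)
    (K : Matrix (W.label i) (V.label i) ℂ) : Matrix W.Idx V.Idx ℂ :=
  Matrix.of fun b a => if ∀ j (h : j ≠ i), b j = e j h (a j) then K (b i) (a i) else 0

open scoped Classical ComplexOrder in
/-- A remembering one-step LOCC channel
`ρ ↦ ∑_y ((K_y)_i ⊗ |y⟩⟨f(y)|) ρ ((K_y^*)_i ⊗ |f(y)⟩⟨y|)`:
party `i` reads the register, applies a local instrument that depends on its value, and writes the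
outcome to the register, where `f y` is the old value that the new value `y` remembers. The Kraus
operators satisfy `∑_y K_y^* K_y ⊗ |f(y)⟩⟨f(y)| ≤ I`. -/
def IsRememberingStep {V W : PartiteSpace k} {X Y : Type} [Fintype Y]
    (M : RegOp V X → RegOp W Y) : Prop :=
  ∃ (i : Fin k) (e : ∀ j, j ≠ i → V.label j ≃ W.label j) (f : Y → X)
    (K : Y → Matrix (W.label i) (V.label i) ℂ),
    (∀ x, (1 - ∑ y with f y = x, (K y).conjTranspose * K y).PosSemidef) ∧
    ∀ ρ y, M ρ y = localOp i e (K y) * ρ (f y) * (localOp i e (K y)).conjTranspose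

/-- Finite compositions `Λ_n ∘ ⋯ ∘ Λ_1` of remembering one-step LOCC channels. -/
inductive IsProtocol : ∀ {V W : PartiteSpace k} {X Y : Type}, (RegOp V X → RegOp W Y) → Prop
  | nil {V : PartiteSpace k} {X : Type} : IsProtocol (id : RegOp V X → RegOp V X)
  | cons {U V W : PartiteSpace k} {X Y Z : Type} [Fintype Z] {Λ : RegOp U X → RegOp V Y}
      {M : RegOp V Y → RegOp W Z} :
      IsProtocol Λ → IsRememberingStep M → IsProtocol (M ∘ Λ)

open Classical in
/-- Coarse-graining of the classical register along `g`. For a one-point `Y` this is the partial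
trace over the register. -/
def forget {V : PartiteSpace k} {X Y : Type} [Fintype X] (g : X → Y) (ρ : RegOp V X) : RegOp V Y :=
  fun y => ∑ x with g x = y, ρ x

/-- LOCC channels (trace non-increasing): a succession of remembering one-step LOCC channels,
after which (part of) the information in the classical register is discarded. -/
def IsLOCC {V W : PartiteSpace k} {X Y : Type} (Λ : RegOp V X → RegOp W Y) : Prop :=
  ∃ (Z : Type) (_ : Fintype Z) (Λ' : RegOp V X → RegOp W Z) (g : Z → Y),
    IsProtocol Λ' ∧ Λ = forget g ∘ Λ'

/-- The operator `|v⟩⟨v|`. -/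
def ketBra {V : PartiteSpace k} (v : EuclideanSpace ℂ V.Idx) : Matrix V.Idx V.Idx ℂ :=
  Matrix.vecMulVec v.ofLp (star v.ofLp)

/-- `ψ → φ` by LOCC: a (trace non-increasing) LOCC channel maps `|ψ⟩⟨ψ|` to `|φ⟩⟨φ|`, i.e. transforms
`ψ/‖ψ‖` to `φ/‖φ‖` with success probability `‖φ‖² / ‖ψ‖²`. -/
def LOCCTransforms (ψ φ : PartiteVec k) : Prop :=
  ∃ Λ : RegOp ψ.space Unit → RegOp φ.space Unit, IsLOCC Λ ∧
    Λ (fun _ => ketBra ψ.vec) = fun _ => ketBra φ.vec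

/-! ### Logarithmic spectral points -/

/-- The binary Shannon entropy in bits. -/
def binEntropy₂ (p : ℝ) : ℝ := -(p * Real.logb 2 p) - (1 - p) * Real.logb 2 (1 - p)

/-- The axioms of a logarithmic spectral point with scaling exponent `α`. Only the values of `E` at
nonzero vectors matter. -/
structure IsLogSpectralPoint (α : ℝ) (E : PartiteVec k → ℝ) : Prop where
  scaling : ∀ (p : ℝ) (ψ : PartiteVec k), 0 < p → ψ.vec ≠ 0 →
    E (ψ.scale √p) = E ψ + α / (1 - α) * Real.logb 2 p
  normalized : ∀ r : ℕ, 1 ≤ r → E (unitTensor k r) = 1 / (1 - α) * Real.logb 2 r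
  additive : ∀ ψ φ : PartiteVec k, ψ.vec ≠ 0 → φ.vec ≠ 0 → E (ψ.tensor φ) = E ψ + E φ
  directSum : ∀ ψ φ : PartiteVec k, ψ.vec ≠ 0 → φ.vec ≠ 0 →
    IsGreatest ((fun t : ℝ => t * E ψ + (1 - t) * E φ + 1 / (1 - α) * binEntropy₂ t) ''
      Set.Icc 0 1) (E (ψ.directSum φ))
  monotone : ∀ ψ φ : PartiteVec k, ψ.vec ≠ 0 → φ.vec ≠ 0 → LOCCTransforms ψ φ → E φ ≤ E ψ

/-- The set `Δ_{log,k}` of logarithmic spectral points of the asymptotic spectrum of LOCC. -/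
def logSpectrum (k : ℕ) : Set (PartiteVec k → ℝ) :=
  {E | ∃ α : ℝ, 0 ≤ α ∧ α < 1 ∧ IsLogSpectralPoint α E}

/-! ### The functionals `F_{sub,k}` on unit vectors -/

/-- The tensor product has multiplicative norm. -/
theorem PartiteVec.norm_tensor (ψ φ : PartiteVec k) :
    ‖(ψ.tensor φ).vec‖ = ‖ψ.vec‖ * ‖φ.vec‖ := by
  rw [EuclideanSpace.norm_eq, EuclideanSpace.norm_eq, EuclideanSpace.norm_eq,
    ← Real.sqrt_mul (Finset.sum_nonneg fun _ _ => sq_nonneg _)]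
  congr 1
  rw [Finset.sum_mul_sum, ← Finset.sum_product']
  let eq : (∀ j, ψ.space.label j × φ.space.label j) ≃ ψ.space.Idx × φ.space.Idx :=
    { toFun := fun x => (fun j => (x j).1, fun j => (x j).2)
      invFun := fun p j => (p.1 j, p.2 j)
      left_inv := fun _ => rfl
      right_inv := fun _ => rfl }
  refine Fintype.sum_equiv eq _ _ fun x => ?_
  simp only [PartiteVec.tensor, norm_mul, mul_pow]
  rfl

/-- The tensor product of unit vectors. -/
def UnitPartiteVec.tensor (ψ φ : UnitPartiteVec k) : UnitPartiteVec k :=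
  ⟨ψ.1.tensor φ.1, by rw [PartiteVec.norm_tensor, ψ.2, φ.2, mul_one]⟩

/-- The unit vector `ψ / ‖ψ‖`. -/
def PartiteVec.normalize (ψ : PartiteVec k) (h : ψ.vec ≠ 0) : UnitPartiteVec k :=
  ⟨ψ.scale ‖ψ.vec‖⁻¹, by
    have h0 : ‖ψ.vec‖ ≠ 0 := norm_ne_zero_iff.2 h
    change ‖((‖ψ.vec‖⁻¹ : ℝ) : ℂ) • ψ.vec‖ = 1
    rw [norm_smul, Complex.norm_real, norm_inv, norm_norm, inv_mul_cancel₀ h0]⟩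

/-- `E (ψ₁ ⊗ ψ₂) ≤ E ψ₁ + E ψ₂`. -/
def IsSubadditive (E : UnitPartiteVec k → ℝ) : Prop :=
  ∀ ψ φ : UnitPartiteVec k, E (ψ.tensor φ) ≤ E ψ + E φ

/-- `E (ψ₁ ⊕ ⋯ ⊕ ψ_l) ≤ max_i E (ψ_i / ‖ψ_i‖) + log l` whenever the nonzero vectors `ψ_i` are such
that `ψ₁ ⊕ ⋯ ⊕ ψ_l` is a unit vector (so that `l ≥ 1`). -/
def IsLogBounded (E : UnitPartiteVec k → ℝ) : Prop :=
  ∀ (l : ℕ) (ψ : Fin l → PartiteVec k) (h0 : ∀ i, (ψ i).vec ≠ 0)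
    (h1 : ‖(PartiteVec.bigSum ψ).vec‖ = 1),
    E ⟨PartiteVec.bigSum ψ, h1⟩ ≤ (⨆ i, E ((ψ i).normalize (h0 i))) + Real.logb 2 l

/-- Monotonicity on average under LOCC: if an LOCC channel maps `|ψ⟩⟨ψ|` to
`∑_x P(x) |φ_x⟩⟨φ_x| ⊗ |x⟩⟨x|`, where `P` is a probability distribution and the `φ_x` are unit vectors
(in one `k`-partite space `W`), then `∑_x P(x) E(φ_x) ≤ E(ψ)`. -/
def IsMonotoneOnAverage (E : UnitPartiteVec k → ℝ) : Prop :=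
  ∀ (ψ : UnitPartiteVec k) (W : PartiteSpace k) (X : Type) [Fintype X] (P : X → ℝ)
    (φ : X → EuclideanSpace ℂ W.Idx) (hφ : ∀ x, ‖φ x‖ = 1)
    (Λ : RegOp ψ.1.space Unit → RegOp W X),
    (∀ x, 0 ≤ P x) → ∑ x, P x = 1 → IsLOCC Λ →
    Λ (fun _ => ketBra ψ.1.vec) = (fun x => (P x : ℂ) • ketBra (φ x)) →
    ∑ x, P x * E ⟨⟨W, φ x⟩, hφ x⟩ ≤ E ψ

/-- The set `F_{sub,k}` of nonnegative functionals on `k`-partite unit vectors that are subadditive,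
logarithmically bounded and monotone on average. -/
def subFunctionals (k : ℕ) : Set (UnitPartiteVec k → ℝ) :=
  {E | (∀ ψ, 0 ≤ E ψ) ∧ IsSubadditive E ∧ IsLogBounded E ∧ IsMonotoneOnAverage E}

end LOCCSpectrum

end

noncomputable section

namespace LOCCSpectrum

/-! ### Relabellings and local measurements as LOCC transformations of pure states -/

variable {k : ℕ}

/-! Subadditivity is contained in additivity, so three properties remain. The main one is
monotonicity on average, because the axioms only compare single pure states. Write `a = α / (1 -
α)`. Let party `i` measure with Kraus operators `K y` on each of `n` copies of `v`, and keep the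
outcome sequences of one type. Permuting the copies, at all parties at once and depending on the
register, brings these outcomes to the same product vector, so forgetting the outcome leaves a pure
state: `√N` times that product, with `N` the size of the type class. Monotonicity, scaling and
additivity give `∑ s, E (K (y s) v) + a log N ≤ n E v` (`type_bound`).

Now average over sequences `y` drawn with probability `q = ∏ s, p (y s)`. The mean of `log (N q)` is
minus the entropy of the type, and there are only polynomially many types, so it is at least `-|Y|
log (n + 1)`. Dividing by `n` removes this term and leaves `∑ y, p y (E (K y v) - a log (p y)) ≤ E
v`; for unit `v` each bracket is `E` of the normalized outcome. This is `sum_weightedValue_le`.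

A protocol acts on ensembles of unnormalized vectors. If it loses no probability in total, no step
loses any in any branch, so the one-step inequality chains. The final discarding is harmless: the
vectors merged into a pure state are all proportional to it.

Nonnegativity follows from the one-step inequality by measuring every party in its basis: the
outcomes live in a one-dimensional space, where unit vectors have the value of `⟨1⟩`, which is zero.

Logarithmic boundedness is an induction from the binary direct sum axiom. Since `1 / (1 - α) = 1 +
a`, one unit of entropy pays for the number of summands and the remaining `a` units for their norms.
-/

/-- The vector `(I ⊗ ⋯ ⊗ K ⊗ ⋯ ⊗ I) v`. -/
def localApply {V W : PartiteSpace k} (i : Fin k) (e : ∀ j, j ≠ i → V.label j ≃ W.label j)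
    (K : Matrix (W.label i) (V.label i) ℂ) (v : EuclideanSpace ℂ V.Idx) :
    EuclideanSpace ℂ W.Idx :=
  WithLp.toLp 2 ((localOp i e K).mulVec v.ofLp)

lemma mul_ketBra_mul {V W : PartiteSpace k} (A : Matrix W.Idx V.Idx ℂ)
    (v : EuclideanSpace ℂ V.Idx) :
    A * ketBra v * A.conjTranspose = ketBra (WithLp.toLp 2 (A.mulVec v.ofLp)) := by
  simp only [ketBra]
  rw [Matrix.mul_vecMulVec, Matrix.vecMulVec_mul, Matrix.star_mulVec]

lemma ketBra_apply {V : PartiteSpace k} (v : EuclideanSpace ℂ V.Idx) (a b : V.Idx) :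
    ketBra v a b = v a * star (v b) := by
  simp [ketBra, Matrix.vecMulVec_apply]

lemma ketBra_smul {V : PartiteSpace k} (c : ℂ) (v : EuclideanSpace ℂ V.Idx) :
    ketBra (c • v) = (‖c‖ ^ 2 : ℂ) • ketBra v := by
  ext a b
  simp only [ketBra_apply, PiLp.smul_apply, smul_eq_mul, Matrix.smul_apply, star_mul']
  have : (‖c‖ ^ 2 : ℂ) = c * star c := by
    rw [← Complex.mul_conj' c]; rfl
  rw [this]; ring

open Classical in
/-- The matrix that maps the basis vector `π b` to the basis vector `b`. -/
def relabelMatrix {A B : Type} (π : B ≃ A) : Matrix B A ℂ :=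
  Matrix.of fun b a => if a = π b then 1 else 0

open Classical in
lemma relabelMatrix_isometry {A B : Type} [Fintype B] (π : B ≃ A) :
    (relabelMatrix π).conjTranspose * relabelMatrix π = 1 := by
  ext a a'
  rw [Matrix.mul_apply, Finset.sum_eq_single (π.symm a)]
  · simp [relabelMatrix, Matrix.one_apply, eq_comm]
  · intro b _ hb
    have : a ≠ π b := fun h => hb (by simp [h])
    simp [relabelMatrix, this]
  · simp

/-- A single Kraus operator suffices to relabel all parties, since a step carries free
identifications `e` at the parties other than `i`. -/
lemma localApply_relabel {V W : PartiteSpace k} (i : Fin k)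
    (e : ∀ j, j ≠ i → V.label j ≃ W.label j) (π : ∀ j, W.label j ≃ V.label j)
    (hπ : ∀ j h, e j h = (π j).symm) (v : EuclideanSpace ℂ V.Idx) :
    localApply i e (relabelMatrix (π i)) v
      = WithLp.toLp 2 fun b : W.Idx => v fun j => π j (b j) := by
  classical
  ext b
  simp only [localApply, Matrix.mulVec, dotProduct, localOp, Matrix.of_apply, relabelMatrix]
  rw [Finset.sum_eq_single fun j => π j (b j)]
  · rw [if_pos fun j h => by simp [hπ j h]]
    simp
  · intro a _ ha
    by_cases h1 : ∀ j (h : j ≠ i), b j = e j h (a j)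
    · have h2 : a i ≠ π i (b i) := by
        intro h2
        apply ha
        funext j
        by_cases h : j = i
        · subst h; exact h2
        · rw [h1 j h, hπ j h]; simp
      simp [h2]
    · simp [h1]
  · simp

open Classical in
/-- Register-dependent local relabellings at the parties in `T`, appended to a protocol. -/
lemma IsProtocol.exists_relabel {V W : PartiteSpace k} {X Y : Type} [Fintype Y]
    {Λ : RegOp V X → RegOp W Y} (hΛ : IsProtocol Λ) (ρ : RegOp V X)
    (v : Y → EuclideanSpace ℂ W.Idx) (hv : Λ ρ = fun y => ketBra (v y))
    (σ : Y → ∀ j, Equiv.Perm (W.label j)) (T : Finset (Fin k)) :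
    ∃ Λ' : RegOp V X → RegOp W Y, IsProtocol Λ' ∧
      Λ' ρ = fun y => ketBra (WithLp.toLp 2 fun b : W.Idx =>
        v y fun j => if j ∈ T then σ y j (b j) else b j) := by
  induction T using Finset.induction_on with
  | empty => exact ⟨Λ, hΛ, by simpa using hv⟩
  | insert i T hi ih =>
    obtain ⟨Λ', h1, h2⟩ := ih
    let M : RegOp W Y → RegOp W Y := fun ρ y =>
      localOp i (fun j _ => Equiv.refl (W.label j)) (relabelMatrix (σ y i)) * ρ y *
        (localOp i (fun j _ => Equiv.refl (W.label j)) (relabelMatrix (σ y i))).conjTranspose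
    have hM : IsRememberingStep M := by
      refine ⟨i, fun j _ => Equiv.refl _, id, fun y => relabelMatrix (σ y i), fun x => ?_,
        fun _ _ => rfl⟩
      have h : (1 - ∑ y with id y = x, (relabelMatrix (σ y i)).conjTranspose *
          relabelMatrix (σ y i)) = (0 : Matrix (W.label i) (W.label i) ℂ) := by
        have hf : (Finset.univ.filter fun y : Y => id y = x) = {x} := by ext; simp
        rw [hf, Finset.sum_singleton, relabelMatrix_isometry, sub_self]
      rw [h]
      exact @Matrix.PosSemidef.zero _ ℂ _ Complex.partialOrder _
    refine ⟨M ∘ Λ', h1.cons hM, ?_⟩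
    funext y
    simp only [Function.comp_apply, h2, M, mul_ketBra_mul]
    congr 1
    have := localApply_relabel i (fun j _ => Equiv.refl (W.label j))
      (fun j => if j = i then σ y j else Equiv.refl _)
      (fun j h => by simp [h]) (WithLp.toLp 2 fun b : W.Idx =>
        v y fun j => if j ∈ T then σ y j (b j) else b j)
    rw [if_pos rfl] at this
    rw [localApply] at this
    rw [this]
    ext b
    refine congrArg (v y).ofLp (funext fun j => ?_)
    by_cases hj : j = i
    · subst hj; simp [hi]
    · simp [hj]

open scoped Classical ComplexOrder in
/-- A local measurement, followed by register-dependent relabellings that bring all the outcomes to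
a common form, after which the outcome is forgotten. -/
lemma locc_of_measurement {V W : PartiteSpace k} {Y : Type} [Fintype Y] (i : Fin k)
    (e : ∀ j, j ≠ i → V.label j ≃ W.label j) (K : Y → Matrix (W.label i) (V.label i) ℂ)
    (hK : (1 - ∑ y, (K y).conjTranspose * K y).PosSemidef)
    (σ : Y → ∀ j, Equiv.Perm (W.label j)) (v : EuclideanSpace ℂ V.Idx)
    (w : EuclideanSpace ℂ W.Idx)
    (hw : ∑ y, ketBra (WithLp.toLp 2 fun b : W.Idx =>
      localApply i e (K y) v fun j => σ y j (b j)) = ketBra w) :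
    LOCCTransforms (⟨V, v⟩ : PartiteVec k) ⟨W, w⟩ := by
  let M : RegOp V Unit → RegOp W Y := fun ρ y =>
      localOp i e (K y) * ρ () * (localOp i e (K y)).conjTranspose
  have hM : IsRememberingStep M :=
    ⟨i, e, fun _ => (), K, fun _ => by simpa using hK, fun _ _ => rfl⟩
  obtain ⟨Λ, h1, h2⟩ := (IsProtocol.nil.cons hM).exists_relabel (fun _ => ketBra v)
    (fun y => localApply i e (K y) v) (by
      funext y; simp only [Function.comp_apply, id, M, mul_ketBra_mul]; rfl) σ Finset.univ
  refine ⟨forget (fun _ => ()) ∘ Λ, ⟨Y, inferInstance, Λ, _, h1, rfl⟩, ?_⟩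
  funext u
  simp only [Function.comp_apply]
  change forget _ (Λ fun _ => ketBra v) u = _
  rw [h2, ← hw]
  simp [forget]

/-- The empty protocol does this; it makes `E` blind to phases. -/
lemma locc_of_ketBra_eq {V : PartiteSpace k} {v w : EuclideanSpace ℂ V.Idx}
    (h : ketBra v = ketBra w) : LOCCTransforms (⟨V, v⟩ : PartiteVec k) ⟨V, w⟩ := by
  refine ⟨forget id ∘ id, ⟨Unit, inferInstance, id, id, IsProtocol.nil, rfl⟩, ?_⟩
  funext u
  simp [forget, h]

lemma locc_relabel (i : Fin k) {V W : PartiteSpace k} (π : ∀ j, W.label j ≃ V.label j)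
    (v : EuclideanSpace ℂ V.Idx) :
    LOCCTransforms (⟨V, v⟩ : PartiteVec k) ⟨W, WithLp.toLp 2 fun b => v fun j => π j (b j)⟩ := by
  classical
  refine locc_of_measurement (Y := Unit) i (fun j _ => (π j).symm)
    (fun _ => relabelMatrix (π i)) ?_ (fun _ j => Equiv.refl _) v _ ?_
  · have h : (1 - ∑ y : Unit, (relabelMatrix (π i)).conjTranspose * relabelMatrix (π i)) =
        (0 : Matrix (V.label i) (V.label i) ℂ) := by
      simp [relabelMatrix_isometry]
    convert Matrix.PosSemidef.zero
  · simp [localApply_relabel i (fun j _ => (π j).symm) π fun _ _ => rfl]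

/-! ### Invariance under relabelling, and behaviour under scaling -/

namespace IsLogSpectralPoint

variable {α : ℝ} {E : PartiteVec k → ℝ}

lemma congr_ketBra (hE : IsLogSpectralPoint α E) {V : PartiteSpace k}
    {v w : EuclideanSpace ℂ V.Idx} (hv : v ≠ 0) (hw : w ≠ 0) (h : ketBra v = ketBra w) :
    E ⟨V, v⟩ = E ⟨V, w⟩ :=
  le_antisymm (hE.monotone _ _ hw hv (locc_of_ketBra_eq h.symm))
    (hE.monotone _ _ hv hw (locc_of_ketBra_eq h))

lemma relabel (hE : IsLogSpectralPoint α E) (hk : 1 ≤ k) {V W : PartiteSpace k}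
    (π : ∀ j, W.label j ≃ V.label j) {v : EuclideanSpace ℂ V.Idx} {w : EuclideanSpace ℂ W.Idx}
    (hv : v ≠ 0) (h : ∀ b : W.Idx, w b = v fun j => π j (b j)) :
    w ≠ 0 ∧ E ⟨W, w⟩ = E ⟨V, v⟩ := by
  have h' : ∀ a : V.Idx, v a = w fun j => (π j).symm (a j) := fun a => by rw [h]; simp
  have hw : w ≠ 0 := by
    rintro rfl
    exact hv (by ext a; simp [h' a])
  have e1 : (WithLp.toLp 2 fun b : W.Idx => v fun j => π j (b j)) = w := by
    ext b; simp [h b]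
  have e2 : (WithLp.toLp 2 fun a : V.Idx => w fun j => (π j).symm (a j)) = v := by
    ext b; simp [h' b]
  have l1 := locc_relabel ⟨0, hk⟩ π v
  have l2 := locc_relabel ⟨0, hk⟩ (fun j => (π j).symm) w
  rw [e1] at l1
  rw [e2] at l2
  exact ⟨hw, le_antisymm (hE.monotone _ _ hv hw l1) (hE.monotone _ _ hw hv l2)⟩

lemma scale_pos (hE : IsLogSpectralPoint α E) {V : PartiteSpace k}
    {v : EuclideanSpace ℂ V.Idx} (hv : v ≠ 0) {c : ℝ} (hc : 0 < c) :
    E ⟨V, (c : ℂ) • v⟩ = E ⟨V, v⟩ + α / (1 - α) * Real.logb 2 (c ^ 2) := by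
  have := hE.scaling (c ^ 2) ⟨V, v⟩ (by positivity) hv
  rwa [Real.sqrt_sq hc.le] at this

end IsLogSpectralPoint

/-! ### Tensor powers of vectors and of measurements -/

/-- The `n`-fold tensor power of a `k`-partite space. -/
abbrev PartiteSpace.pow (V : PartiteSpace k) (n : ℕ) : PartiteSpace k :=
  ⟨fun j => Fin n → V.label j⟩

/-- The tensor product of `n` vectors in one `k`-partite space. -/
def prodVec {V : PartiteSpace k} {n : ℕ} (v : Fin n → EuclideanSpace ℂ V.Idx) :
    EuclideanSpace ℂ (V.pow n).Idx :=
  WithLp.toLp 2 fun x : (∀ j, Fin n → V.label j) => ∏ s, v s fun j => x j s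

lemma prodVec_apply {V : PartiteSpace k} {n : ℕ} (v : Fin n → EuclideanSpace ℂ V.Idx)
    (x : ∀ j, Fin n → V.label j) : prodVec v x = ∏ s, v s fun j => x j s := rfl

lemma prodVec_ne_zero {V : PartiteSpace k} {n : ℕ} {v : Fin n → EuclideanSpace ℂ V.Idx}
    (hv : ∀ s, v s ≠ 0) : prodVec v ≠ 0 := by
  have h : ∀ s, ∃ a, v s a ≠ 0 := fun s => by
    by_contra! h
    exact hv s (by ext a; simpa using h a)
  choose a ha using h
  intro h0
  have := congrArg (fun w : EuclideanSpace ℂ (V.pow n).Idx => w fun j s => a s j) h0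
  simp only [prodVec_apply, PiLp.zero_apply] at this
  exact Finset.prod_ne_zero_iff.2 (fun s _ => ha s) this

/-- The tensor product of `n` matrices. -/
def piKron {A B : Type} {n : ℕ} (K : Fin n → Matrix B A ℂ) :
    Matrix (Fin n → B) (Fin n → A) ℂ :=
  Matrix.of fun b a => ∏ s, K s (b s) (a s)

lemma sum_piKron {A B Y : Type} [Fintype B] [Fintype Y] {n : ℕ} (K : Y → Matrix B A ℂ) :
    ∑ y : Fin n → Y, (piKron fun s => K (y s)).conjTranspose * piKron (fun s => K (y s)) =
      piKron fun _ : Fin n => ∑ y, (K y).conjTranspose * K y := by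
  classical
  ext a a'
  simp only [Matrix.sum_apply, Matrix.mul_apply, piKron, Matrix.of_apply,
    Matrix.conjTranspose_apply, star_prod, ← Finset.prod_mul_distrib]
  rw [Finset.prod_univ_sum, Fintype.piFinset_univ]
  refine Finset.sum_congr rfl fun y _ => ?_
  rw [Finset.prod_univ_sum, Fintype.piFinset_univ]

-- Induction through `1 - M ⊗ N = (1 - M) ⊗ 1 + M ⊗ (1 - N)`, a sum of positive terms.
open scoped ComplexOrder Kronecker in
lemma one_sub_piKron_posSemidef {A : Type} [Fintype A] [DecidableEq A] {M : Matrix A A ℂ}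
    (hM : M.PosSemidef) (hM' : (1 - M).PosSemidef) (n : ℕ) :
    (1 - piKron fun _ : Fin n => M).PosSemidef := by
  induction n with
  | zero =>
    have : (1 - piKron fun _ : Fin 0 => M) = 0 := by
      ext a b; simp [piKron, Subsingleton.elim a b]
    rw [this]; exact Matrix.PosSemidef.zero
  | succ n ih =>
    have : (1 - piKron fun _ : Fin (n + 1) => M) =
        ((1 - M) ⊗ₖ (1 : Matrix (Fin n → A) (Fin n → A) ℂ) +
          M ⊗ₖ (1 - piKron fun _ : Fin n => M)).submatrix
        (Fin.consEquiv fun _ => A).symm (Fin.consEquiv fun _ => A).symm := by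
      have h : (1 - M) ⊗ₖ (1 : Matrix (Fin n → A) (Fin n → A) ℂ) +
          M ⊗ₖ (1 - piKron fun _ : Fin n => M) = 1 - M ⊗ₖ (piKron fun _ : Fin n => M) := by
        rw [← Matrix.one_kronecker_one]
        ext a b
        simp only [Matrix.add_apply, Matrix.sub_apply, Matrix.kroneckerMap_apply]
        ring
      rw [h]
      ext a b
      simp only [Matrix.submatrix_apply, Matrix.sub_apply, Matrix.one_apply,
        EmbeddingLike.apply_eq_iff_eq]
      simp [piKron, Fin.prod_univ_succ, Fin.consEquiv, Fin.tail]
    rw [this]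
    exact ((hM'.kronecker Matrix.PosSemidef.one).add (hM.kronecker ih)).submatrix _

open scoped ComplexOrder in
/-- A set of outcomes of an `n`-fold repeated measurement. -/
lemma one_sub_sum_piKron_posSemidef {A B Y : Type} [Fintype A] [DecidableEq A] [Fintype B]
    [Fintype Y] {K : Y → Matrix B A ℂ}
    (hK : (1 - ∑ y, (K y).conjTranspose * K y).PosSemidef) (n : ℕ) (p : (Fin n → Y) → Prop)
    [DecidablePred p] :
    (1 - ∑ y : {y // p y}, (piKron fun s => K (y.1 s)).conjTranspose *
      piKron (fun s => K (y.1 s))).PosSemidef := by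
  classical
  have h := one_sub_piKron_posSemidef (Matrix.posSemidef_sum Finset.univ fun y _ =>
    Matrix.posSemidef_conjTranspose_mul_self (K y)) hK n
  rw [← sum_piKron, ← Fintype.sum_subtype_add_sum_subtype p] at h
  -- The outcomes left out contribute a positive operator to the defect.
  have h' : (∑ y : {y // ¬ p y}, (piKron fun s => K (y.1 s)).conjTranspose *
      piKron (fun s => K (y.1 s))).PosSemidef :=
    Matrix.posSemidef_sum _ fun y _ => Matrix.posSemidef_conjTranspose_mul_self _
  convert h.add h' using 1
  abel

/-- Distributivity, after exchanging the roles of parties and copies in the summation index with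
`Equiv.piComm`. -/
lemma localApply_piKron {V W : PartiteSpace k} {n : ℕ} (i : Fin k)
    (e : ∀ j, j ≠ i → V.label j ≃ W.label j) (K : Fin n → Matrix (W.label i) (V.label i) ℂ)
    (v : Fin n → EuclideanSpace ℂ V.Idx) :
    localApply (V := V.pow n) (W := W.pow n) i (fun j h => (Equiv.refl (Fin n)).arrowCongr (e j h))
      (piKron K) (prodVec v) = prodVec fun s => localApply i e (K s) (v s) := by
  classical
  ext b
  rw [prodVec_apply]
  simp only [localApply, Matrix.mulVec, dotProduct]
  rw [Finset.prod_univ_sum, Fintype.piFinset_univ,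
    ← (Equiv.piComm fun (_ : Fin n) (j : Fin k) => V.label j).sum_comp]
  refine Finset.sum_congr rfl fun a _ => ?_
  rw [prodVec_apply, Finset.prod_mul_distrib]
  congr 1
  simp only [localOp, Matrix.of_apply, piKron, Equiv.piComm_apply, Function.swap]
  rw [Finset.prod_ite_zero]
  congr 1
  simp only [Finset.mem_univ, true_imp_iff, eq_iff_iff]
  constructor
  · intro h s j hj
    rw [h j hj]; rfl
  · intro h j hj
    funext s
    rw [h s j hj]; rfl

lemma unitTensor_one_apply (x : (unitTensor k 1).space.Idx) : (unitTensor k 1).vec x = 1 := by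
  classical
  have hx : x = fun _ => (0 : Fin 1) := funext fun _ => Subsingleton.elim (α := Fin 1) _ _
  subst hx
  have h : (unitTensor k 1).vec = WithLp.toLp 2 fun x : (Fin k → Fin 1) =>
      ∑ a : Fin 1, if x = (fun _ => a) then (1 : ℂ) else 0 := by
    simp only [unitTensor]
  rw [h]
  change (∑ a : Fin 1, if (fun _ : Fin k => (0 : Fin 1)) = (fun _ => a) then (1 : ℂ) else 0) = 1
  rw [Fintype.sum_unique]
  exact if_pos rfl

lemma unitTensor_one_ne_zero : (unitTensor k 1).vec ≠ 0 := fun h => by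
  have := unitTensor_one_apply (k := k) fun _ => (0 : Fin 1)
  rw [h] at this
  exact zero_ne_one (α := ℂ) this

namespace IsLogSpectralPoint

variable {α : ℝ} {E : PartiteVec k → ℝ}

lemma unitTensor_one (hE : IsLogSpectralPoint α E) : E (unitTensor k 1) = 0 := by
  simpa using hE.normalized 1 le_rfl

lemma prodVec (hE : IsLogSpectralPoint α E) (hk : 1 ≤ k) {V : PartiteSpace k} {n : ℕ}
    {v : Fin n → EuclideanSpace ℂ V.Idx} (hv : ∀ s, v s ≠ 0) :
    E ⟨V.pow n, prodVec v⟩ = ∑ s, E ⟨V, v s⟩ := by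
  induction n with
  | zero =>
    have hp : ∀ b : (V.pow 0).Idx, LOCCSpectrum.prodVec v b = 1 := fun b => by
      rw [prodVec_apply]; simp
    have := (hE.relabel hk (V := (unitTensor k 1).space) (W := V.pow 0)
      (fun j => Equiv.ofUnique (Fin 0 → V.label j) (Fin 1)) unitTensor_one_ne_zero
      (w := LOCCSpectrum.prodVec v)
      (fun b => (hp b).trans (unitTensor_one_apply _).symm)).2
    rw [this]
    simpa using hE.unitTensor_one
  | succ n ih =>
    have h0 := prodVec_ne_zero fun s : Fin n => hv s.succ
    have ht : (PartiteVec.tensor ⟨V, v 0⟩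
        ⟨V.pow n, LOCCSpectrum.prodVec fun s : Fin n => v s.succ⟩).vec ≠ 0 := by
      rw [← norm_ne_zero_iff, PartiteVec.norm_tensor]
      exact mul_ne_zero (norm_ne_zero_iff.2 (hv 0)) (norm_ne_zero_iff.2 h0)
    have := (hE.relabel hk (W := V.pow (n + 1))
      (fun j => (Fin.consEquiv fun _ => V.label j).symm) ht
      (w := LOCCSpectrum.prodVec v) (fun b => by
        rw [prodVec_apply, Fin.prod_univ_succ]; rfl)).2
    rw [this]
    have h2 := hE.additive ⟨V, v 0⟩ ⟨V.pow n, LOCCSpectrum.prodVec fun s : Fin n => v s.succ⟩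
      (hv 0) h0
    refine h2.trans ?_
    rw [ih fun s => hv s.succ, Fin.sum_univ_succ]

end IsLogSpectralPoint

/-! ### The method of types -/

section Types

variable {Y : Type} {n : ℕ}

open Classical in
/-- The type of a sequence: how often each letter occurs. -/
def seqType (y : Fin n → Y) : Y → Fin (n + 1) := fun a =>
  ⟨(Finset.univ.filter fun s => y s = a).card,
    Nat.lt_succ_of_le ((Finset.card_le_univ _).trans (Fintype.card_fin n).le)⟩

lemma exists_perm_of_seqType_eq {y z : Fin n → Y} (h : seqType y = seqType z) :
    ∃ σ : Equiv.Perm (Fin n), ∀ s, y s = z (σ s) := by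
  classical
  have hc : ∀ a, Fintype.card {s // y s = a} = Fintype.card {s // z s = a} := fun a => by
    have := congrArg Fin.val (congrFun h a)
    simp only [seqType] at this
    rw [Fintype.card_subtype, Fintype.card_subtype]
    convert this
  exact ⟨Equiv.ofFiberEquiv fun a => Fintype.equivOfCardEq (hc a),
    fun s => (Equiv.ofFiberEquiv_map (fun a => Fintype.equivOfCardEq (hc a)) s).symm⟩

open Classical in
/-- The number of sequences of the same type. -/
def typeCard [Fintype Y] (y : Fin n → Y) : ℕ := Fintype.card {z : Fin n → Y // seqType z = seqType y}

lemma typeCard_pos [Fintype Y] (y : Fin n → Y) : 0 < typeCard y :=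
  Fintype.card_pos_iff.2 ⟨⟨y, rfl⟩⟩

/-- Each nonempty type class contributes exactly one, and a type is a map from `Y` to `Fin (n + 1)`.
-/
lemma sum_inv_typeCard_le [Fintype Y] :
    ∑ y : Fin n → Y, ((typeCard y : ℝ))⁻¹ ≤ ((n : ℝ) + 1) ^ Fintype.card Y := by
  classical
  rw [← Finset.sum_fiberwise Finset.univ (seqType : (Fin n → Y) → Y → Fin (n + 1))]
  calc _ ≤ ∑ _c : Y → Fin (n + 1), (1 : ℝ) := by
        refine Finset.sum_le_sum fun c _ => ?_
        by_cases hc : ∃ y : Fin n → Y, seqType y = c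
        · obtain ⟨y, rfl⟩ := hc
          have : ∀ z ∈ Finset.univ.filter (fun z : Fin n → Y => seqType z = seqType y),
              ((typeCard z : ℝ))⁻¹ = (typeCard y : ℝ)⁻¹ := fun z hz => by
            simp only [typeCard, (Finset.mem_filter.1 hz).2]
          rw [Finset.sum_congr rfl this, Finset.sum_const, nsmul_eq_mul]
          refine le_of_eq ?_
          have h2 : (Finset.univ.filter (fun z : Fin n → Y => seqType z = seqType y)).card
              = typeCard y := by
            rw [typeCard, Fintype.card_subtype]
          rw [h2]
          exact mul_inv_cancel₀ (by exact_mod_cast (typeCard_pos y).ne')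
        · push Not at hc
          simp [hc]
    _ = _ := by simp

/-- The probabilities of the sequences sum to one. -/
lemma sum_prod_eq_one [Fintype Y] {p : Y → ℝ} (hp : ∑ y, p y = 1) :
    ∑ y : Fin n → Y, ∏ s, p (y s) = 1 := by
  classical
  rw [← Fintype.piFinset_univ, ← Finset.prod_univ_sum (fun _ => Finset.univ) fun _ => p]
  simp [hp]

lemma sum_prod_mul_eq [Fintype Y] {p : Y → ℝ} (hp : ∑ y, p y = 1) (g : Y → ℝ) (s : Fin n) :
    ∑ y : Fin n → Y, (∏ s, p (y s)) * g (y s) = ∑ y, p y * g y := by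
  classical
  have h : ∀ y : Fin n → Y, (∏ s, p (y s)) * g (y s) =
      ∏ t, p (y t) * if t = s then g (y t) else 1 := fun y => by
    rw [Finset.prod_mul_distrib, Finset.prod_ite_eq' Finset.univ s]; simp
  simp_rw [h]
  rw [← Fintype.piFinset_univ, ← Finset.prod_univ_sum (fun _ => Finset.univ)
    fun t a => p a * if t = s then g a else 1, Finset.prod_eq_single s]
  · simp
  · intro t _ ht
    simp [ht, hp]
  · simp

/-- Up to a polynomial, the type of a random sequence has no entropy. -/
lemma entropy_type_le [Fintype Y] {p : Y → ℝ} (hp0 : ∀ y, 0 ≤ p y) (hp : ∑ y, p y = 1) :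
    -(Fintype.card Y * Real.logb 2 (n + 1)) ≤
      ∑ y : Fin n → Y, (∏ s, p (y s)) * Real.logb 2 (typeCard y * ∏ s, p (y s)) := by
  set T : ℝ := ((n : ℝ) + 1) ^ Fintype.card Y with hT
  have hT0 : 0 < T := by positivity
  have hl2 : 0 < Real.log 2 := Real.log_pos one_lt_two
  -- With `N` the size of the type class, the weights `1 / (T N)` sum to at most one. The claim is
  -- then a Gibbs inequality, proved termwise from `1 - 1/x ≤ log x` at `x = T N q`.
  have key : ∀ y : Fin n → Y, (∏ s, p (y s)) * (-Real.logb 2 T) +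
      ((∏ s, p (y s)) - T⁻¹ * (typeCard y : ℝ)⁻¹) / Real.log 2 ≤
      (∏ s, p (y s)) * Real.logb 2 (typeCard y * ∏ s, p (y s)) := by
    intro y
    have hN : (0 : ℝ) < typeCard y := by exact_mod_cast typeCard_pos y
    rcases (Finset.prod_nonneg fun s _ => hp0 (y s) : 0 ≤ ∏ s, p (y s)).eq_or_lt with h | h
    · rw [← h]
      have : 0 ≤ T⁻¹ * (typeCard y : ℝ)⁻¹ / Real.log 2 := by positivity
      simp only [zero_mul, zero_sub, zero_add, neg_div]
      linarith
    · set q := ∏ s, p (y s)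
      have hx : 0 < T * (typeCard y * q) := by positivity
      have h1 := Real.one_sub_inv_le_log_of_pos hx
      rw [Real.log_mul hT0.ne' (by positivity)] at h1
      have h2 : q * (1 - (T * (typeCard y * q))⁻¹) / Real.log 2 =
          (q - T⁻¹ * (typeCard y : ℝ)⁻¹) / Real.log 2 := by
        congr 1
        field_simp
      rw [← h2]
      simp only [Real.logb]
      rw [mul_div_assoc, ← mul_add]
      refine mul_le_mul_of_nonneg_left ?_ h.le
      rw [← neg_div, ← add_div]
      exact div_le_div_of_nonneg_right (by linarith) hl2.le
  refine le_trans ?_ (Finset.sum_le_sum fun y _ => key y)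
  rw [Finset.sum_add_distrib, ← Finset.sum_mul, ← Finset.sum_div, Finset.sum_sub_distrib,
    sum_prod_eq_one hp, ← Finset.mul_sum, hT, Real.logb_pow, ← hT]
  have h1 : T⁻¹ * ∑ y : Fin n → Y, (typeCard y : ℝ)⁻¹ ≤ 1 := by
    rw [inv_mul_le_iff₀ hT0, mul_one]
    exact sum_inv_typeCard_le
  have h2 : 0 ≤ (1 - T⁻¹ * ∑ y : Fin n → Y, (typeCard y : ℝ)⁻¹) / Real.log 2 :=
    div_nonneg (by linarith) hl2.le
  linarith

lemma le_of_forall_nat_mul_le {x e C : ℝ} (hC : 0 ≤ C)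
    (h : ∀ n : ℕ, n * x ≤ n * e + C * Real.logb 2 (n + 1)) : x ≤ e := by
  by_contra! hlt
  have hl2 : 0 < Real.log 2 := Real.log_pos one_lt_two
  obtain ⟨m, hm⟩ := exists_nat_gt (max 1 (2 * C / Real.log 2 / (x - e) + 1))
  have hm1 : (1 : ℝ) < m := (le_max_left _ _).trans_lt hm
  have hm2 : 2 * C / Real.log 2 / (x - e) + 1 < m := (le_max_right _ _).trans_lt hm
  -- With `n + 1 = m ^ 2` the logarithm is `2 log m ≤ 2 m`, linear in `m`, against a left side
  -- quadratic in `m`.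
  have hn := h (m ^ 2 - 1)
  have hm1' : 1 ≤ m ^ 2 := Nat.one_le_pow _ _ (by exact_mod_cast (zero_lt_one.trans hm1))
  rw [Nat.cast_sub hm1'] at hn
  push_cast at hn
  rw [sub_add_cancel, Real.logb_pow, Real.logb] at hn
  have hlog : Real.log m ≤ m := (Real.log_le_sub_one_of_pos (by linarith)).trans (by linarith)
  have h3 : C * (2 * (Real.log m / Real.log 2)) ≤ 2 * C / Real.log 2 * m := by
    have : 2 * C / Real.log 2 * Real.log m ≤ 2 * C / Real.log 2 * m :=
      mul_le_mul_of_nonneg_left hlog (by positivity)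
    calc _ = 2 * C / Real.log 2 * Real.log m := by ring
      _ ≤ _ := this
  have h4 : 2 * C / Real.log 2 < (m - 1) * (x - e) := by
    rw [← div_lt_iff₀ (by linarith)]; linarith
  have h5 : ((m : ℝ) ^ 2 - 1) * (x - e) < (m - 1) * (x - e) * m := by
    have := mul_lt_mul_of_pos_right h4 (zero_lt_one.trans hm1)
    push_cast at hn
    nlinarith
  nlinarith [mul_pos (sub_pos.2 hm1) (sub_pos.2 hlt)]

/-- A bound for the sequences of each type gives a bound on average. -/
lemma average_le_of_type_bound [Fintype Y] {p g : Y → ℝ} (hp0 : ∀ y, 0 ≤ p y)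
    (hp : ∑ y, p y = 1) {a e : ℝ} (ha : 0 ≤ a)
    (H : ∀ (n : ℕ) (y : Fin n → Y), (∀ s, 0 < p (y s)) →
      ∑ s, (g (y s) + a * Real.logb 2 (p (y s))) + a * Real.logb 2 (typeCard y) ≤ n * e) :
    ∑ y, p y * g y ≤ e := by
  refine le_of_forall_nat_mul_le (C := a * Fintype.card Y) (by positivity) fun n => ?_
  have h1 : ∀ y : Fin n → Y, (∏ s, p (y s)) * ∑ s, g (y s) +
      a * ((∏ s, p (y s)) * Real.logb 2 (typeCard y * ∏ s, p (y s))) ≤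
      (∏ s, p (y s)) * (n * e) := by
    intro y
    by_cases hy : ∀ s, 0 < p (y s)
    · have hq : 0 < ∏ s, p (y s) := Finset.prod_pos fun s _ => hy s
      have hN : (0 : ℝ) < typeCard y := by exact_mod_cast typeCard_pos y
      have h2 := mul_le_mul_of_nonneg_left (H n y hy) hq.le
      rw [Real.logb_mul hN.ne' hq.ne', Real.logb_prod _ _ fun s _ => (hy s).ne']
      rw [Finset.sum_add_distrib, ← Finset.mul_sum] at h2
      linarith
    · push Not at hy
      obtain ⟨s, hs⟩ := hy
      have : ∏ s, p (y s) = 0 := Finset.prod_eq_zero (Finset.mem_univ s) (le_antisymm hs (hp0 _))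
      simp [this]
  have h2 := Finset.sum_le_sum fun y (_ : y ∈ Finset.univ) => h1 y
  rw [Finset.sum_add_distrib, ← Finset.mul_sum, ← Finset.sum_mul, sum_prod_eq_one hp] at h2
  simp_rw [Finset.mul_sum] at h2
  rw [Finset.sum_comm] at h2
  simp_rw [sum_prod_mul_eq hp] at h2
  rw [Finset.sum_const, Finset.card_univ, Fintype.card_fin, nsmul_eq_mul] at h2
  have h3 := mul_le_mul_of_nonneg_left (entropy_type_le (n := n) hp0 hp) ha
  rw [Finset.mul_sum] at h3
  linarith

end Types

/-! ### Repeated measurements and the one-step average inequality -/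

lemma prodVec_perm {V : PartiteSpace k} {n : ℕ} (σ : Equiv.Perm (Fin n))
    (v w : Fin n → EuclideanSpace ℂ V.Idx) (h : ∀ s, v s = w (σ s)) :
    (WithLp.toLp 2 fun b : (V.pow n).Idx =>
      prodVec v fun j => σ.symm.arrowCongr (Equiv.refl (V.label j)) (b j)) = prodVec w := by
  ext b
  change (∏ s, v s fun j => b j (σ s)) = ∏ s, w s fun j => b j s
  rw [← Equiv.prod_comp σ fun s => w s fun j => b j s]
  exact Finset.prod_congr rfl fun s _ => by rw [h s]

-- All sequences in the type class of `y` lead to the same product vector after permuting copies.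
-- Forgetting which one occurred multiplies the operator by `typeCard y`, hence the square root on
-- the vector.
open scoped Classical ComplexOrder in
lemma locc_of_type {V W : PartiteSpace k} {Y : Type}
    [Fintype Y] (i : Fin k) (e : ∀ j, j ≠ i → V.label j ≃ W.label j)
    (K : Y → Matrix (W.label i) (V.label i) ℂ)
    (hK : (1 - ∑ y, (K y).conjTranspose * K y).PosSemidef) (v : EuclideanSpace ℂ V.Idx)
    (n : ℕ) (y : Fin n → Y) :
    LOCCTransforms (⟨V.pow n, prodVec fun _ => v⟩ : PartiteVec k)
      ⟨W.pow n, ((√(typeCard y) : ℝ) : ℂ) • prodVec fun s => localApply i e (K (y s)) v⟩ := by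
  have hσ : ∀ z : {z : Fin n → Y // seqType z = seqType y},
      ∃ σ : Equiv.Perm (Fin n), ∀ s, z.1 s = y (σ s) := fun z => exists_perm_of_seqType_eq z.2
  choose σ hσ using hσ
  refine locc_of_measurement (V := V.pow n) (W := W.pow n) i
    (fun j h => (Equiv.refl (Fin n)).arrowCongr (e j h))
    (fun z : {z : Fin n → Y // seqType z = seqType y} => piKron fun s => K (z.1 s)) ?_
    (fun z j => (σ z).symm.arrowCongr (Equiv.refl (W.label j))) _ _ ?_
  · convert one_sub_sum_piKron_posSemidef hK n _
  · have h : ∀ z : {z : Fin n → Y // seqType z = seqType y}, _ :=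
      fun z => prodVec_perm (σ z) (fun s => localApply i e (K (z.1 s)) v)
        (fun s => localApply i e (K (y s)) v) fun s => by rw [hσ z s]
    simp_rw [localApply_piKron]
    rw [Finset.sum_congr rfl fun z _ => congrArg ketBra (h z), Finset.sum_const, Finset.card_univ,
      ketBra_smul, Complex.norm_real, Real.norm_of_nonneg (Real.sqrt_nonneg _),
      ← Complex.ofReal_pow, Real.sq_sqrt (Nat.cast_nonneg _), ← Nat.cast_smul_eq_nsmul ℂ,
      Complex.ofReal_natCast]
    rfl

namespace IsLogSpectralPoint

variable {α : ℝ} {E : PartiteVec k → ℝ}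

open scoped Classical ComplexOrder in
/-- Repeat a measurement, keep the outcome sequences of one type, and forget the outcomes. -/
lemma type_bound (hE : IsLogSpectralPoint α E) (hk : 1 ≤ k) {V W : PartiteSpace k} {Y : Type}
    [Fintype Y] (i : Fin k) (e : ∀ j, j ≠ i → V.label j ≃ W.label j)
    (K : Y → Matrix (W.label i) (V.label i) ℂ)
    (hK : (1 - ∑ y, (K y).conjTranspose * K y).PosSemidef) {v : EuclideanSpace ℂ V.Idx}
    (hv : v ≠ 0) (n : ℕ) (y : Fin n → Y) (hy : ∀ s, localApply i e (K (y s)) v ≠ 0) :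
    ∑ s, E ⟨W, localApply i e (K (y s)) v⟩ + α / (1 - α) * Real.logb 2 (typeCard y) ≤
      n * E ⟨V, v⟩ := by
  have hN : (0 : ℝ) < typeCard y := by exact_mod_cast typeCard_pos y
  have hw0 := prodVec_ne_zero hy
  have hsq : (0 : ℝ) < √(typeCard y) := Real.sqrt_pos.2 hN
  have h2 := hE.monotone _ _ (prodVec_ne_zero fun _ => hv)
    (smul_ne_zero (Complex.ofReal_ne_zero.2 hsq.ne') hw0) (locc_of_type i e K hK v n y)
  rw [hE.scale_pos hw0 hsq, Real.sq_sqrt hN.le, hE.prodVec hk hy,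
    hE.prodVec hk fun _ => hv] at h2
  simpa using h2

/-- The value of `E` at the normalized vector, weighted with the squared norm. -/
def _root_.LOCCSpectrum.weightedValue (α : ℝ) (E : PartiteVec k → ℝ) {V : PartiteSpace k}
    (v : EuclideanSpace ℂ V.Idx) : ℝ :=
  ‖v‖ ^ 2 * (E ⟨V, v⟩ - α / (1 - α) * Real.logb 2 (‖v‖ ^ 2))

open scoped Classical ComplexOrder in
/-- Monotonicity on average under a measurement at one party. -/
lemma sum_weightedValue_le (hE : IsLogSpectralPoint α E) (hk : 1 ≤ k) (hα0 : 0 ≤ α) (hα1 : α < 1)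
    {V W : PartiteSpace k} {Y : Type} [Fintype Y] (i : Fin k)
    (e : ∀ j, j ≠ i → V.label j ≃ W.label j) (K : Y → Matrix (W.label i) (V.label i) ℂ)
    (hK : (1 - ∑ y, (K y).conjTranspose * K y).PosSemidef) {v : EuclideanSpace ℂ V.Idx}
    (hv : ∑ y, ‖localApply i e (K y) v‖ ^ 2 = ‖v‖ ^ 2) :
    ∑ y, weightedValue α E (localApply i e (K y) v) ≤ weightedValue α E v := by
  by_cases hv0 : v = 0
  · subst hv0
    simp [weightedValue, localApply]
  have hn : 0 < ‖v‖ ^ 2 := by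
    have := norm_pos_iff.2 hv0
    positivity
  set a := α / (1 - α) with ha
  have ha0 : 0 ≤ a := div_nonneg hα0 (by linarith)
  -- The correction in `g` is chosen so that `g y + a log (p y)` is the value at the unnormalized
  -- outcome, which is what `type_bound` controls. Outcomes with zero vector have `p y = 0` and
  -- never enter.
  have h := average_le_of_type_bound (Y := Y)
    (p := fun y => ‖localApply i e (K y) v‖ ^ 2 / ‖v‖ ^ 2)
    (g := fun y => E ⟨W, localApply i e (K y) v⟩ -
      a * Real.logb 2 (‖localApply i e (K y) v‖ ^ 2 / ‖v‖ ^ 2)) (e := E ⟨V, v⟩)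
    (fun y => by positivity) (by rw [← Finset.sum_div, hv, div_self hn.ne']) ha0
    (fun n y hy => by
      simp only [sub_add_cancel]
      refine hE.type_bound hk i e K hK hv0 n y fun s h0 => ?_
      have := hy s
      simp [h0] at this)
  have h2 := mul_le_mul_of_nonneg_left h hn.le
  rw [Finset.mul_sum] at h2
  have h3 : ∀ y, ‖v‖ ^ 2 * (‖localApply i e (K y) v‖ ^ 2 / ‖v‖ ^ 2 *
      (E ⟨W, localApply i e (K y) v⟩ -
        a * Real.logb 2 (‖localApply i e (K y) v‖ ^ 2 / ‖v‖ ^ 2))) =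
      weightedValue α E (localApply i e (K y) v) +
        ‖localApply i e (K y) v‖ ^ 2 * (a * Real.logb 2 (‖v‖ ^ 2)) := by
    intro y
    rw [← mul_assoc, mul_div_cancel₀ _ hn.ne', weightedValue, ← ha]
    by_cases h0 : ‖localApply i e (K y) v‖ ^ 2 = 0
    · simp [h0]
    · rw [Real.logb_div h0 hn.ne']; ring
  rw [Finset.sum_congr rfl fun y _ => h3 y, Finset.sum_add_distrib, ← Finset.sum_mul, hv] at h2
  have h4 : weightedValue α E v = ‖v‖ ^ 2 * (E ⟨V, v⟩ - a * Real.logb 2 (‖v‖ ^ 2)) := rfl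
  rw [h4]
  linarith

end IsLogSpectralPoint

/-! ### Local operators and norms -/

open Classical in
lemma conjTranspose_localOp_mul {V W : PartiteSpace k} (i : Fin k)
    (e : ∀ j, j ≠ i → V.label j ≃ W.label j) (K L : Matrix (W.label i) (V.label i) ℂ) :
    (localOp i e K).conjTranspose * localOp i e L =
      localOp i (fun j _ => Equiv.refl (V.label j)) (K.conjTranspose * L) := by
  ext a a'
  simp only [Matrix.mul_apply, Matrix.conjTranspose_apply, localOp, Matrix.of_apply]
  -- The only indices with a nonzero term agree with `a` under `e` away from `i`; they are
  -- parametrized by their entry at `i`.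
  let s : W.label i → W.Idx := fun c j => if h : j = i then h ▸ c else e j h (a j)
  have hsi : ∀ c, s c i = c := fun c => by simp [s]
  have hsj : ∀ c j (h : j ≠ i), s c j = e j h (a j) := fun c j h => by simp [s, h]
  have hs : Function.Injective s := fun c c' h => by rw [← hsi c, h, hsi]
  split_ifs with h
  · refine (Fintype.sum_of_injective s hs _ _ ?_ ?_).symm
    · intro b hb
      have : ¬ ∀ j (h : j ≠ i), b j = e j h (a j) := fun h' => hb ⟨b i, by
        funext j
        by_cases hj : j = i
        · subst hj; exact hsi _
        · rw [hsj _ j hj, h' j hj]⟩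
      rw [if_neg this, star_zero, zero_mul]
    · intro c
      rw [if_pos (hsj c), if_pos fun j hj => by rw [hsj c j hj, h j hj]; rfl, hsi]
  · refine Finset.sum_eq_zero fun b _ => ?_
    by_contra h0
    apply h
    intro j hj
    have h1 : ∀ j (h : j ≠ i), b j = e j h (a j) := by
      by_contra h1
      rw [if_neg h1, star_zero, zero_mul] at h0
      exact h0 rfl
    have h2 : ∀ j (h : j ≠ i), b j = e j h (a' j) := by
      by_contra h1
      rw [if_neg h1, mul_zero] at h0
      exact h0 rfl
    exact (e j hj).injective ((h1 j hj).symm.trans (h2 j hj))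

open Classical in
lemma localOp_one {V : PartiteSpace k} (i : Fin k) :
    localOp i (fun j _ => Equiv.refl (V.label j)) 1 = (1 : Matrix V.Idx V.Idx ℂ) := by
  ext a b
  simp only [localOp, Matrix.of_apply, Matrix.one_apply]
  by_cases h : a = b
  · subst h; simp
  · rw [if_neg h]
    by_cases h1 : ∀ j, j ≠ i → a j = b j
    · refine (if_pos h1).trans (if_neg fun h2 => ?_)
      refine h (funext fun j => ?_)
      by_cases hj : j = i
      · subst hj; exact h2
      · exact h1 j hj
    · exact if_neg h1

open Classical in
lemma localOp_sub {V W : PartiteSpace k} (i : Fin k) (e : ∀ j, j ≠ i → V.label j ≃ W.label j)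
    (K L : Matrix (W.label i) (V.label i) ℂ) :
    localOp i e (K - L) = localOp i e K - localOp i e L := by
  ext a b
  simp only [localOp, Matrix.of_apply, Matrix.sub_apply]
  split_ifs <;> simp

open Classical in
lemma localOp_sum {V W : PartiteSpace k} {Y : Type} [Fintype Y] (i : Fin k)
    (e : ∀ j, j ≠ i → V.label j ≃ W.label j) (K : Y → Matrix (W.label i) (V.label i) ℂ) :
    localOp i e (∑ y, K y) = ∑ y, localOp i e (K y) := by
  ext a b
  simp only [localOp, Matrix.of_apply, Matrix.sum_apply]
  split_ifs <;> simp

lemma star_dotProduct_self {ι : Type} [Fintype ι] (u : ι → ℂ) :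
    star u ⬝ᵥ u = ((‖WithLp.toLp 2 u‖ ^ 2 : ℝ) : ℂ) := by
  rw [EuclideanSpace.norm_sq_eq]
  push_cast
  exact Finset.sum_congr rfl fun a _ => Complex.conj_mul' _

lemma star_dotProduct_mulVec {ι κ : Type} [Fintype ι] [Fintype κ] (A : Matrix κ ι ℂ) (u : ι → ℂ) :
    star u ⬝ᵥ (A.conjTranspose * A).mulVec u = ((‖WithLp.toLp 2 (A.mulVec u)‖ ^ 2 : ℝ) : ℂ) := by
  rw [← star_dotProduct_self, Matrix.star_mulVec, ← Matrix.mulVec_mulVec, Matrix.dotProduct_mulVec]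

-- The probability lost in a measurement is the expectation of its defect `1 - ∑ K* K`.
open Classical in
lemma norm_sq_sub_sum_localApply {V W : PartiteSpace k} {Y : Type} [Fintype Y] (i : Fin k)
    (e : ∀ j, j ≠ i → V.label j ≃ W.label j) (K : Y → Matrix (W.label i) (V.label i) ℂ)
    (v : EuclideanSpace ℂ V.Idx) :
    ((‖v‖ ^ 2 - ∑ y, ‖localApply i e (K y) v‖ ^ 2 : ℝ) : ℂ) =
      star v.ofLp ⬝ᵥ (localOp i (fun j _ => Equiv.refl (V.label j))
        (1 - ∑ y, (K y).conjTranspose * K y)).mulVec v.ofLp := by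
  rw [localOp_sub, localOp_one, localOp_sum, Matrix.sub_mulVec, dotProduct_sub, Matrix.one_mulVec,
    star_dotProduct_self, Matrix.sum_mulVec, dotProduct_sum]
  simp only [← conjTranspose_localOp_mul i e, star_dotProduct_mulVec]
  push_cast
  rfl

open scoped Classical ComplexOrder MatrixOrder Matrix.Norms.L2Operator in
lemma sum_norm_sq_localApply_le {V W : PartiteSpace k} {Y : Type} [Fintype Y] (i : Fin k)
    (e : ∀ j, j ≠ i → V.label j ≃ W.label j) (K : Y → Matrix (W.label i) (V.label i) ℂ)
    (hK : (1 - ∑ y, (K y).conjTranspose * K y).PosSemidef) (v : EuclideanSpace ℂ V.Idx) :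
    ∑ y, ‖localApply i e (K y) v‖ ^ 2 ≤ ‖v‖ ^ 2 := by
  have h := norm_sq_sub_sum_localApply i e K v
  -- Writing the defect as `B* B` turns its expectation into a squared norm.
  obtain ⟨B, hB⟩ := CStarAlgebra.nonneg_iff_eq_star_mul_self.mp hK.nonneg
  rw [Matrix.star_eq_conjTranspose] at hB
  rw [hB, ← conjTranspose_localOp_mul, star_dotProduct_mulVec, Complex.ofReal_inj] at h
  have := sq_nonneg ‖WithLp.toLp 2
    ((localOp i (fun j _ => Equiv.refl (V.label j)) B).mulVec v.ofLp)‖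
  linarith

open Classical in
lemma sum_norm_sq_localApply_eq {V W : PartiteSpace k} {Y : Type} [Fintype Y] (i : Fin k)
    (e : ∀ j, j ≠ i → V.label j ≃ W.label j) (K : Y → Matrix (W.label i) (V.label i) ℂ)
    (hK : ∑ y, (K y).conjTranspose * K y = 1) (v : EuclideanSpace ℂ V.Idx) :
    ∑ y, ‖localApply i e (K y) v‖ ^ 2 = ‖v‖ ^ 2 := by
  have h := norm_sq_sub_sum_localApply i e K v
  have h0 : localOp i (fun j _ => Equiv.refl (V.label j))
      (1 - ∑ y, (K y).conjTranspose * K y) = 0 := by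
    rw [hK, sub_self]
    ext a b
    simp only [localOp, Matrix.of_apply, Matrix.zero_apply]
    split_ifs <;> rfl
  rw [h0, Matrix.zero_mulVec, dotProduct_zero, Complex.ofReal_eq_zero] at h
  linarith

namespace IsLogSpectralPoint

variable {α : ℝ} {E : PartiteVec k → ℝ}

lemma smul (hE : IsLogSpectralPoint α E) {V : PartiteSpace k} {v : EuclideanSpace ℂ V.Idx}
    (hv : v ≠ 0) {c : ℂ} (hc : c ≠ 0) :
    E ⟨V, c • v⟩ = E ⟨V, v⟩ + α / (1 - α) * Real.logb 2 (‖c‖ ^ 2) := by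
  have hc' : 0 < ‖c‖ := norm_pos_iff.2 hc
  rw [← hE.scale_pos hv hc']
  refine hE.congr_ketBra (smul_ne_zero hc hv)
    (smul_ne_zero (Complex.ofReal_ne_zero.2 hc'.ne') hv) ?_
  rw [ketBra_smul, ketBra_smul, Complex.norm_real, norm_norm]

lemma weightedValue_smul (hE : IsLogSpectralPoint α E) {V : PartiteSpace k}
    {v : EuclideanSpace ℂ V.Idx} (hv : ‖v‖ = 1) (c : ℂ) :
    weightedValue α E (c • v) = ‖c • v‖ ^ 2 * E ⟨V, v⟩ := by
  by_cases hc : c = 0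
  · simp [hc, weightedValue]
  · have hv0 : v ≠ 0 := by rintro rfl; simp at hv
    rw [weightedValue, hE.smul hv0 hc, norm_smul, hv]
    ring_nf

/-! ### Nonnegativity -/

lemma _root_.LOCCSpectrum.PartiteSpace.exists_replace (V : PartiteSpace k) (i : Fin k) (B : Type)
    [Fintype B] : ∃ W : PartiteSpace k, Nonempty (W.label i ≃ B) ∧
      ∀ j, j ≠ i → Nonempty (V.label j ≃ W.label j) := by
  let W : PartiteSpace k :=
    { label := fun j => if j = i then B else V.label j
      fin := fun j => by split_ifs <;> infer_instance }
  exact ⟨W, ⟨Equiv.cast (if_pos rfl)⟩, fun j hj => ⟨Equiv.cast (if_neg hj).symm⟩⟩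

/-- Here `T` holds the parties whose local space may still be nontrivial. Measuring one of them
removes it from `T` and bounds `E` below by an average of nonnegative values. -/
lemma nonneg_of_card_le_one (hE : IsLogSpectralPoint α E) (hk : 1 ≤ k) (hα0 : 0 ≤ α)
    (hα1 : α < 1) (T : Finset (Fin k)) : ∀ (V : PartiteSpace k) (v : EuclideanSpace ℂ V.Idx),
      ‖v‖ = 1 → (∀ j, j ∉ T → Nonempty (V.label j ≃ Fin 1)) → 0 ≤ E ⟨V, v⟩ := by
  classical
  induction T using Finset.induction_on with
  | empty =>
    intro V v hv hT
    have π : ∀ j, V.label j ≃ Fin 1 := fun j => (hT j (Finset.notMem_empty j)).some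
    obtain ⟨h1, h2⟩ := hE.relabel hk (W := V) (V := (unitTensor k 1).space) π
      unitTensor_one_ne_zero (w := WithLp.toLp 2 fun _ => 1)
      (fun b => (unitTensor_one_apply _).symm)
    have : Unique V.Idx :=
      { default := fun j => (π j).symm 0
        uniq := fun a => funext fun j => (π j).injective (Subsingleton.elim _ _) }
    have hvc : v = v default • (WithLp.toLp 2 fun _ => 1 : EuclideanSpace ℂ V.Idx) := by
      ext a
      rw [Unique.eq_default a]
      simp
    have hn : ‖v default‖ = 1 := by
      rw [EuclideanSpace.norm_eq, Fintype.sum_unique, Real.sqrt_sq (norm_nonneg _)] at hv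
      exact hv
    have hc : v default ≠ 0 := by
      intro h; rw [h] at hn; simp at hn
    rw [hvc, hE.smul h1 hc, h2, hn]
    refine (le_of_eq ?_)
    have := hE.unitTensor_one
    simp only [one_pow, Real.logb_one, mul_zero, add_zero]
    exact this.symm
  | insert i T hi ih =>
    intro V v hv hT
    obtain ⟨W, ⟨u⟩, he⟩ := V.exists_replace i (Fin 1)
    have e : ∀ j, j ≠ i → V.label j ≃ W.label j := fun j hj => (he j hj).some
    have hW : Unique (W.label i) := u.unique
    -- The bra `⟨a|`: a basis measurement that also collapses the local space to dimension one.
    let K : V.label i → Matrix (W.label i) (V.label i) ℂ :=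
      fun a => Matrix.of fun _ a' => if a' = a then 1 else 0
    have hK : ∑ a, (K a).conjTranspose * K a = 1 := by
      ext a a'
      simp only [Matrix.sum_apply, Matrix.mul_apply, K, Matrix.conjTranspose_apply,
        Matrix.of_apply, Fintype.sum_unique]
      simp [Matrix.one_apply, eq_comm, apply_ite]
    have hn := sum_norm_sq_localApply_eq i e K hK v
    have h := hE.sum_weightedValue_le hk hα0 hα1 i e K
      (by rw [hK, sub_self]; exact @Matrix.PosSemidef.zero _ ℂ _ Complex.partialOrder _) hn
    have h2 : weightedValue α E v = E ⟨V, v⟩ := by simp [weightedValue, hv]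
    rw [h2] at h
    refine le_trans (Finset.sum_nonneg fun a _ => ?_) h
    set w := localApply i e (K a) v
    by_cases hw : w = 0
    · simp [hw, weightedValue]
    · have hw' : ‖w‖ ≠ 0 := norm_ne_zero_iff.2 hw
      have h1 : ‖((‖w‖⁻¹ : ℝ) : ℂ) • w‖ = 1 := by
        rw [norm_smul, Complex.norm_real, norm_inv, norm_norm, inv_mul_cancel₀ hw']
      have h3 : w = ((‖w‖ : ℝ) : ℂ) • (((‖w‖⁻¹ : ℝ) : ℂ) • w) := by
        rw [smul_smul, ← Complex.ofReal_mul, mul_inv_cancel₀ hw', Complex.ofReal_one, one_smul]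
      rw [h3, hE.weightedValue_smul h1]
      refine mul_nonneg (sq_nonneg _) (ih W _ h1 fun j hj => ?_)
      by_cases hji : j = i
      · subst hji; exact ⟨u⟩
      · obtain ⟨f⟩ := hT j (by simp [hji, hj])
        exact ⟨(e j hji).symm.trans f⟩

lemma nonneg (hE : IsLogSpectralPoint α E) (hk : 1 ≤ k) (hα0 : 0 ≤ α) (hα1 : α < 1)
    (ψ : UnitPartiteVec k) : 0 ≤ E ψ.1 :=
  hE.nonneg_of_card_le_one hk hα0 hα1 Finset.univ ψ.1.space ψ.1.vec ψ.2
    fun j hj => absurd (Finset.mem_univ j) hj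

end IsLogSpectralPoint

/-! ### Monotonicity on average -/

lemma IsProtocol.finite {V W : PartiteSpace k} {X Y : Type} {Λ : RegOp V X → RegOp W Y}
    (h : IsProtocol Λ) : Finite X → Finite Y := by
  induction h with
  | nil => exact id
  | cons _ _ _ => exact fun _ => inferInstance

open scoped Classical ComplexOrder in
/-- Protocols map pure ensembles to pure ensembles, do not increase the total probability, and if
they preserve it, do not increase the average value of `E`. -/
lemma IsProtocol.exists_ensemble {α : ℝ} {E : PartiteVec k → ℝ} (hE : IsLogSpectralPoint α E)
    (hk : 1 ≤ k) (hα0 : 0 ≤ α) (hα1 : α < 1) {V W : PartiteSpace k} {X Y : Type}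
    {Λ : RegOp V X → RegOp W Y} (h : IsProtocol Λ) :
    ∀ [Fintype X] [Fintype Y] (v : X → EuclideanSpace ℂ V.Idx),
      ∃ w : Y → EuclideanSpace ℂ W.Idx, (Λ fun x => ketBra (v x)) = (fun y => ketBra (w y)) ∧
        ∑ y, ‖w y‖ ^ 2 ≤ ∑ x, ‖v x‖ ^ 2 ∧
        (∑ y, ‖w y‖ ^ 2 = ∑ x, ‖v x‖ ^ 2 →
          ∑ y, weightedValue α E (w y) ≤ ∑ x, weightedValue α E (v x)) := by
  induction h with
  | nil =>
    intro i1 i2 v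
    cases Subsingleton.elim i1 i2
    exact ⟨v, rfl, le_rfl, fun _ => le_rfl⟩
  | @cons V W X Y Z iZ Λ M hΛ hM ih =>
    intro iX iZ' v
    cases Subsingleton.elim iZ iZ'
    have := hΛ.finite inferInstance
    have := Fintype.ofFinite Y
    obtain ⟨w, hw, hle, hmon⟩ := ih v
    obtain ⟨i, e, f, K, hK, hMK⟩ := hM
    have hK' : ∀ y, (1 - ∑ z : {z // f z = y}, (K z.1).conjTranspose * K z.1).PosSemidef := by
      intro y
      have := hK y
      rwa [Finset.sum_subtype (p := fun z => f z = y) _ (by simp)] at this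
    have h1 : ∀ y, ∑ z : {z // f z = y}, ‖localApply i e (K z.1) (w (f z.1))‖ ^ 2 ≤ ‖w y‖ ^ 2 := by
      intro y
      have := sum_norm_sq_localApply_le i e (fun z : {z // f z = y} => K z.1) (hK' y) (w y)
      refine le_trans (le_of_eq (Finset.sum_congr rfl fun z _ => ?_)) this
      rw [z.2]
    have h2 := Finset.sum_le_sum fun y (_ : y ∈ Finset.univ) => h1 y
    have h3 := Fintype.sum_fiberwise f fun z => ‖localApply i e (K z) (w (f z))‖ ^ 2
    refine ⟨fun z => localApply i e (K z) (w (f z)), ?_, (h3 ▸ h2).trans hle, fun heq => ?_⟩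
    · funext z
      simp only [Function.comp_apply, hw, hMK, mul_ketBra_mul]
      rfl
    · have hw_eq : ∑ y, ‖w y‖ ^ 2 = ∑ x, ‖v x‖ ^ 2 := le_antisymm hle (by
        rw [← heq, ← h3]; exact h2)
      refine le_trans ?_ (hmon hw_eq)
      -- No branch can gain norm, so equality of the totals forces equality for every register
      -- value, as the one-step inequality requires.
      have h4 := (Finset.sum_eq_sum_iff_of_le fun y _ => h1 y).1 (by rw [h3, heq, hw_eq])
      rw [← Fintype.sum_fiberwise f]
      refine Finset.sum_le_sum fun y _ => ?_
      have hc : ∀ z : {z // f z = y}, localApply i e (K z.1) (w (f z.1)) =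
          localApply i e (K z.1) (w y) := fun z => by rw [z.2]
      have h5 := h4 y (Finset.mem_univ y)
      simp only [hc] at h5 ⊢
      exact hE.sum_weightedValue_le hk hα0 hα1 i e (fun z : {z // f z = y} => K z.1) (hK' y) h5

lemma trace_ketBra {V : PartiteSpace k} (v : EuclideanSpace ℂ V.Idx) :
    (ketBra v).trace = ((‖v‖ ^ 2 : ℝ) : ℂ) := by
  rw [ketBra, Matrix.trace_vecMulVec, dotProduct_comm, star_dotProduct_self]

lemma star_dotProduct_ketBra {V : PartiteSpace k} (u v : EuclideanSpace ℂ V.Idx) :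
    star u.ofLp ⬝ᵥ (ketBra v).mulVec u.ofLp = ((‖inner ℂ u v‖ ^ 2 : ℝ) : ℂ) := by
  have h1 : inner ℂ u v = star u.ofLp ⬝ᵥ v.ofLp := by
    rw [EuclideanSpace.inner_eq_star_dotProduct, dotProduct_comm]
  have h2 : star v.ofLp ⬝ᵥ u.ofLp = star (inner ℂ u v) := by
    rw [h1, Matrix.star_dotProduct]
  rw [ketBra, Matrix.vecMulVec_mulVec, h2]
  simp only [op_smul_eq_smul, dotProduct_smul, smul_eq_mul, ← h1]
  rw [Complex.ofReal_pow, ← Complex.mul_conj', mul_comm]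
  rfl

/-- The components of a convex decomposition of a pure state are proportional to it. -/
lemma eq_smul_of_sum_ketBra_eq {V : PartiteSpace k} {Z : Type} (S : Finset Z)
    (w : Z → EuclideanSpace ℂ V.Idx) {φ : EuclideanSpace ℂ V.Idx} (hφ : ‖φ‖ = 1) (p : ℝ)
    (h : ∑ z ∈ S, ketBra (w z) = (p : ℂ) • ketBra φ) {z : Z} (hz : z ∈ S) :
    ∃ c : ℂ, w z = c • φ := by
  set c := inner ℂ φ (w z)
  set u := w z - c • φ with hu
  have hφφ : inner ℂ φ φ = (1 : ℂ) := by
    rw [inner_self_eq_norm_sq_to_K, hφ]; simp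
  have hφu : inner ℂ φ u = (0 : ℂ) := by
    rw [hu, inner_sub_right, inner_smul_right, hφφ, mul_one, sub_self]
  have huφ : inner ℂ u φ = (0 : ℂ) := inner_eq_zero_symm.1 hφu
  -- Testing against `u ⊥ φ` gives a vanishing sum of the squares `|⟨u, w z⟩|²`, so each of them
  -- vanishes.
  have h1 := congrArg (fun A : Matrix V.Idx V.Idx ℂ => star u.ofLp ⬝ᵥ A.mulVec u.ofLp) h
  simp only [Matrix.sum_mulVec, dotProduct_sum, star_dotProduct_ketBra, Matrix.smul_mulVec,
    dotProduct_smul, huφ, ← Complex.ofReal_sum] at h1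
  simp only [norm_zero, ne_eq, OfNat.ofNat_ne_zero, not_false_eq_true, zero_pow,
    Complex.ofReal_zero, smul_zero, Complex.ofReal_eq_zero] at h1
  have h2 := (Finset.sum_eq_zero_iff_of_nonneg fun z _ => sq_nonneg _).1 h1 z hz
  have h3 : inner ℂ u (w z) = (0 : ℂ) := by simpa using h2
  refine ⟨c, sub_eq_zero.1 ?_⟩
  rw [← hu, ← inner_self_eq_zero (𝕜 := ℂ)]
  nth_rw 2 [hu]
  rw [inner_sub_right, inner_smul_right, h3, huφ, mul_zero, sub_zero]

/-- Traces of the output blocks show that no probability is lost before the register is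
coarse-grained. Every vector merged into block `x` is a multiple of `φ x`, so the weighted values
there add up to `P x` times `E` at `φ x`. -/
lemma IsLogSpectralPoint.isMonotoneOnAverage {α : ℝ} {E : PartiteVec k → ℝ}
    (hE : IsLogSpectralPoint α E) (hk : 1 ≤ k) (hα0 : 0 ≤ α) (hα1 : α < 1) :
    IsMonotoneOnAverage fun ψ : UnitPartiteVec k => E ψ.1 := by
  classical
  rintro ψ W X iX P φ hφ Λ hP0 hP ⟨Z, iZ, Λ', g, hΛ', rfl⟩ h
  obtain ⟨w, hw, -, hmon⟩ := hΛ'.exists_ensemble hE hk hα0 hα1 fun _ => ψ.1.vec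
  have hx : ∀ x, ∑ z with g z = x, ketBra (w z) = (P x : ℂ) • ketBra (φ x) := by
    intro x
    have := congrFun h x
    rw [Function.comp_apply, hw] at this
    rw [← this]
    simp only [forget]
  have htr : ∀ x, ∑ z with g z = x, ‖w z‖ ^ 2 = P x := by
    intro x
    have := congrArg Matrix.trace (hx x)
    rw [Matrix.trace_sum, Matrix.trace_smul, trace_ketBra, hφ] at this
    simp only [trace_ketBra, ← Complex.ofReal_sum, one_pow, Complex.ofReal_one, smul_eq_mul,
      mul_one] at this
    exact Complex.ofReal_injective this
  have htot : ∑ z, ‖w z‖ ^ 2 = ∑ _u : Unit, ‖ψ.1.vec‖ ^ 2 := by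
    rw [← Finset.sum_fiberwise Finset.univ g, Finset.sum_congr rfl fun x _ => htr x, hP, ψ.2]
    simp
  have h1 := hmon htot
  rw [← Finset.sum_fiberwise Finset.univ g] at h1
  have h2 : ∀ x, ∑ z with g z = x, weightedValue α E (w z) = P x * E ⟨W, φ x⟩ := by
    intro x
    rw [← htr x, Finset.sum_mul]
    refine Finset.sum_congr rfl fun z hz => ?_
    obtain ⟨c, hc⟩ := eq_smul_of_sum_ketBra_eq _ w (hφ x) (P x) (hx x) hz
    rw [hc, hE.weightedValue_smul (hφ x)]
  rw [Finset.sum_congr rfl fun x _ => h2 x] at h1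
  refine h1.trans (le_of_eq ?_)
  simp [weightedValue, ψ.2]

/-! ### Logarithmic boundedness -/

/-- Gibbs' inequality for `(t, 1 - t)` against `(x, y) / (x + y)`, from `log z ≤ z - 1` in each
term. -/
lemma mul_logb_add_binEntropy_le {t x y : ℝ} (ht : t ∈ Set.Icc (0 : ℝ) 1) (hx : 0 < x)
    (hy : 0 < y) : t * Real.logb 2 x + (1 - t) * Real.logb 2 y + binEntropy₂ t ≤
      Real.logb 2 (x + y) := by
  have hs : 0 < x + y := add_pos hx hy
  have key : ∀ {s z : ℝ}, 0 ≤ s → 0 < z →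
      s * Real.log z - s * Real.log s ≤ s * Real.log (x + y) + z / (x + y) - s := by
    intro s z hs0 hz
    rcases hs0.eq_or_lt with rfl | hs0
    · simp only [zero_mul, sub_zero, zero_add]; positivity
    · have h := Real.log_le_sub_one_of_pos (show 0 < z / (s * (x + y)) by positivity)
      rw [Real.log_div hz.ne' (by positivity), Real.log_mul hs0.ne' hs.ne'] at h
      have h2 := mul_le_mul_of_nonneg_left h hs0.le
      have h3 : s * (z / (s * (x + y)) - 1) = z / (x + y) - s := by field_simp
      rw [h3] at h2
      linarith
  have h1 := key ht.1 hx
  have h2 := key (sub_nonneg.2 ht.2) hy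
  have h3 : x / (x + y) + y / (x + y) = 1 := by rw [← add_div, div_self hs.ne']
  have hl2 : 0 < Real.log 2 := Real.log_pos one_lt_two
  simp only [binEntropy₂, Real.logb]
  have : t * (Real.log x / Real.log 2) + (1 - t) * (Real.log y / Real.log 2) +
      (-(t * (Real.log t / Real.log 2)) - (1 - t) * (Real.log (1 - t) / Real.log 2)) =
      (t * Real.log x - t * Real.log t + ((1 - t) * Real.log y - (1 - t) * Real.log (1 - t))) /
        Real.log 2 := by ring
  rw [this]
  exact div_le_div_of_nonneg_right (by linarith) hl2.le

lemma bigSum_apply_mk (hk : 1 ≤ k) {l : ℕ} (ψ : Fin l → PartiteVec k) (i : Fin l)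
    (a : (ψ i).space.Idx) : (PartiteVec.bigSum ψ).vec (fun j => ⟨i, a j⟩) = (ψ i).vec a := by
  simp only [PartiteVec.bigSum]
  rw [Finset.sum_eq_single i, Finset.sum_eq_single a, if_pos rfl]
  · intro b _ hb
    rw [if_neg]
    exact fun h => hb (funext fun j => (eq_of_heq (Sigma.mk.inj (congrFun h j)).2).symm)
  · exact fun h => absurd (Finset.mem_univ _) h
  · intro i' _ hi
    refine Finset.sum_eq_zero fun b _ => ?_
    rw [if_neg]
    exact fun h => hi (congrArg Sigma.fst (congrFun h ⟨0, hk⟩)).symm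
  · exact fun h => absurd (Finset.mem_univ _) h

lemma bigSum_apply_eq_zero {l : ℕ} (ψ : Fin l → PartiteVec k)
    (x : (PartiteVec.bigSum ψ).space.Idx)
    (hx : ∀ (i : Fin l) (a : (ψ i).space.Idx), x ≠ fun j => ⟨i, a j⟩) :
    (PartiteVec.bigSum ψ).vec x = 0 := by
  simp only [PartiteVec.bigSum]
  refine Finset.sum_eq_zero fun i _ => Finset.sum_eq_zero fun a _ => ?_
  rw [if_neg]
  exact hx i a

lemma directSum_apply_inl (hk : 1 ≤ k) (ψ φ : PartiteVec k) (a : ψ.space.Idx) :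
    (ψ.directSum φ).vec (fun j => Sum.inl (a j)) = ψ.vec a := by
  simp only [PartiteVec.directSum]
  rw [Finset.sum_eq_single a, if_pos rfl, Finset.sum_eq_zero, add_zero]
  · intro b _
    rw [if_neg]
    exact fun h => Sum.inl_ne_inr (congrFun h ⟨0, hk⟩)
  · intro b _ hb
    rw [if_neg]
    exact fun h => hb (funext fun j => (Sum.inl_injective (congrFun h j)).symm)
  · exact fun h => absurd (Finset.mem_univ _) h

lemma directSum_apply_inr (hk : 1 ≤ k) (ψ φ : PartiteVec k) (b : φ.space.Idx) :
    (ψ.directSum φ).vec (fun j => Sum.inr (b j)) = φ.vec b := by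
  simp only [PartiteVec.directSum]
  rw [Finset.sum_eq_zero, Finset.sum_eq_single b, if_pos rfl, zero_add]
  · intro b' _ hb
    rw [if_neg]
    exact fun h => hb (funext fun j => (Sum.inr_injective (congrFun h j)).symm)
  · exact fun h => absurd (Finset.mem_univ _) h
  · intro a _
    rw [if_neg]
    exact fun h => Sum.inr_ne_inl (congrFun h ⟨0, hk⟩)

lemma directSum_apply_eq_zero (ψ φ : PartiteVec k) (x : (ψ.directSum φ).space.Idx)
    (hl : ∀ a : ψ.space.Idx, x ≠ fun j => Sum.inl (a j))
    (hr : ∀ b : φ.space.Idx, x ≠ fun j => Sum.inr (b j)) : (ψ.directSum φ).vec x = 0 := by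
  simp only [PartiteVec.directSum]
  rw [Finset.sum_eq_zero, Finset.sum_eq_zero, add_zero]
  · intro b _
    rw [if_neg]
    exact hr b
  · intro a _
    rw [if_neg]
    exact hl a

/-- The summands have disjoint supports because the label at party `0` records the summand; this
needs a party to exist. -/
lemma norm_sq_bigSum (hk : 1 ≤ k) {l : ℕ} (ψ : Fin l → PartiteVec k) :
    ‖(PartiteVec.bigSum ψ).vec‖ ^ 2 = ∑ i, ‖(ψ i).vec‖ ^ 2 := by
  simp only [EuclideanSpace.norm_sq_eq]
  rw [← Fintype.sum_sigma' fun i (a : (ψ i).space.Idx) => ‖(ψ i).vec a‖ ^ 2]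
  let ι : (Σ i : Fin l, (ψ i).space.Idx) → (PartiteVec.bigSum ψ).space.Idx :=
    fun p j => ⟨p.1, p.2 j⟩
  have hι : Function.Injective ι := by
    rintro ⟨i, a⟩ ⟨i', a'⟩ h
    have h0 : i = i' := congrArg Sigma.fst (congrFun h ⟨0, hk⟩)
    subst h0
    congr 1
    funext j
    exact eq_of_heq (Sigma.mk.inj (congrFun h j)).2
  refine (Fintype.sum_of_injective ι hι _ _ (fun x hx => ?_) fun p => ?_).symm
  · rw [bigSum_apply_eq_zero ψ x fun i a h => hx ⟨⟨i, a⟩, h.symm⟩, norm_zero]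
    exact zero_pow two_ne_zero
  · rw [← bigSum_apply_mk hk ψ p.1 p.2]

/-- Splitting off the first summand. -/
def sumSigmaSuccEquiv {l : ℕ} (L : Fin (l + 1) → Type) :
    (L 0 ⊕ Σ i : Fin l, L i.succ) ≃ Σ i : Fin (l + 1), L i :=
  Equiv.ofBijective (Sum.elim (fun a => ⟨0, a⟩) fun p => ⟨p.1.succ, p.2⟩) <| by
    constructor
    · rintro (a | ⟨i, a⟩) (b | ⟨i', b⟩) h
      · simpa using h
      · exact absurd (congrArg Sigma.fst h) (Fin.succ_ne_zero _).symm
      · exact absurd (congrArg Sigma.fst h) (Fin.succ_ne_zero _)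
      · have h0 : i = i' := Fin.succ_injective _ (congrArg Sigma.fst h)
        subst h0
        simpa using h
    · rintro ⟨i, a⟩
      induction i using Fin.cases with
      | zero => exact ⟨Sum.inl a, rfl⟩
      | succ i => exact ⟨Sum.inr ⟨i, a⟩, rfl⟩

/-- Up to relabelling, the finite tensor sum is an iterated binary one, the only kind that the
axioms speak of. -/
lemma bigSum_succ_apply (hk : 1 ≤ k) {l : ℕ} (ψ : Fin (l + 1) → PartiteVec k)
    (x : ((ψ 0).directSum (PartiteVec.bigSum fun i : Fin l => ψ i.succ)).space.Idx) :
    ((ψ 0).directSum (PartiteVec.bigSum fun i : Fin l => ψ i.succ)).vec x =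
      (PartiteVec.bigSum ψ).vec fun j =>
        sumSigmaSuccEquiv (fun i => (ψ i).space.label j) (x j) := by
  by_cases hl : ∃ a : (ψ 0).space.Idx, x = fun j => Sum.inl (a j)
  · obtain ⟨a, rfl⟩ := hl
    exact (directSum_apply_inl hk _ _ a).trans (bigSum_apply_mk hk ψ 0 a).symm
  by_cases hr : ∃ (i : Fin l) (a : (ψ i.succ).space.Idx), x = fun j => Sum.inr ⟨i, a j⟩
  · obtain ⟨i, a, rfl⟩ := hr
    exact (directSum_apply_inr hk _ _ _).trans
      ((bigSum_apply_mk hk (fun i : Fin l => ψ i.succ) i a).trans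
        (bigSum_apply_mk hk ψ i.succ a).symm)
  push Not at hl hr
  refine Eq.trans ?_ (bigSum_apply_eq_zero ψ _ ?_).symm
  · by_cases hb : ∃ b : (PartiteVec.bigSum fun i : Fin l => ψ i.succ).space.Idx,
        x = fun j => Sum.inr (b j)
    · obtain ⟨b, rfl⟩ := hb
      refine (directSum_apply_inr hk _ _ _).trans (bigSum_apply_eq_zero _ b fun i a h => ?_)
      subst h
      exact hr i a rfl
    · push Not at hb
      exact directSum_apply_eq_zero _ _ x hl hb
  · intro i
    induction i using Fin.cases with
    | zero =>
      intro a h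
      exact hl a (funext fun j => (sumSigmaSuccEquiv fun i => (ψ i).space.label j).injective
        (congrFun h j))
    | succ i =>
      intro a h
      exact hr i a (funext fun j => (sumSigmaSuccEquiv fun i => (ψ i).space.label j).injective
        (congrFun h j))

/-- The case of a single summand. -/
def sigmaOneEquiv (L : Fin 1 → Type) : L 0 ≃ Σ i : Fin 1, L i :=
  Equiv.ofBijective (fun a => ⟨0, a⟩) <| by
    constructor
    · intro a b h
      simpa using h
    · rintro ⟨i, a⟩
      obtain rfl := Subsingleton.elim i 0
      exact ⟨a, rfl⟩

lemma bigSum_one_apply (hk : 1 ≤ k) (ψ : Fin 1 → PartiteVec k) (x : (ψ 0).space.Idx) :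
    (ψ 0).vec x = (PartiteVec.bigSum ψ).vec fun j =>
      sigmaOneEquiv (fun i => (ψ i).space.label j) (x j) :=
  (bigSum_apply_mk hk ψ 0 x).symm

namespace IsLogSpectralPoint

variable {α : ℝ} {E : PartiteVec k → ℝ}

/-- Stated for unnormalized vectors, since the tail of a unit sum is not a unit vector. The
hypothesis says that the normalized summands have value at most `m`. -/
lemma bigSum_le (hE : IsLogSpectralPoint α E) (hk : 1 ≤ k) (hα0 : 0 ≤ α) (hα1 : α < 1) (m : ℝ)
    (l : ℕ) : ∀ ψ : Fin (l + 1) → PartiteVec k, (∀ i, (ψ i).vec ≠ 0) →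
      (∀ i, E (ψ i) ≤ m + α / (1 - α) * Real.logb 2 (‖(ψ i).vec‖ ^ 2)) →
      E (PartiteVec.bigSum ψ) ≤ m + Real.logb 2 (l + 1) +
        α / (1 - α) * Real.logb 2 (∑ i, ‖(ψ i).vec‖ ^ 2) := by
  have ha0 : 0 ≤ α / (1 - α) := div_nonneg hα0 (by linarith)
  have ha1 : 1 / (1 - α) = 1 + α / (1 - α) := by
    have : 1 - α ≠ 0 := by linarith
    field_simp
    ring
  have hpos : ∀ {l : ℕ} (ψ : Fin (l + 1) → PartiteVec k), (∀ i, (ψ i).vec ≠ 0) →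
      0 < ∑ i, ‖(ψ i).vec‖ ^ 2 := fun ψ h0 =>
    Finset.sum_pos (fun i _ => pow_pos (norm_pos_iff.2 (h0 i)) 2) Finset.univ_nonempty
  have hne : ∀ {l : ℕ} (ψ : Fin (l + 1) → PartiteVec k), (∀ i, (ψ i).vec ≠ 0) →
      (PartiteVec.bigSum ψ).vec ≠ 0 := fun ψ h0 h => by
    have := norm_sq_bigSum hk ψ
    rw [h, norm_zero] at this
    have := hpos ψ h0
    simp_all
  induction l with
  | zero =>
    intro ψ h0 hm
    have h := (hE.relabel hk (V := (PartiteVec.bigSum ψ).space) (W := (ψ 0).space)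
      (fun j => sigmaOneEquiv fun i => (ψ i).space.label j) (hne ψ h0)
      (bigSum_one_apply hk ψ)).2
    change E (ψ 0) = E (PartiteVec.bigSum ψ) at h
    rw [← h]
    simpa using hm 0
  | succ l ih =>
    intro ψ h0 hm
    have h := (hE.relabel hk (V := (PartiteVec.bigSum ψ).space)
      (W := ((ψ 0).directSum (PartiteVec.bigSum fun i : Fin (l + 1) => ψ i.succ)).space)
      (fun j => sumSigmaSuccEquiv fun i => (ψ i).space.label j) (hne ψ h0)
      (bigSum_succ_apply hk ψ)).2
    change E ((ψ 0).directSum _) = E (PartiteVec.bigSum ψ) at h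
    rw [← h]
    have hq0 : 0 < ‖(ψ 0).vec‖ ^ 2 := pow_pos (norm_pos_iff.2 (h0 0)) 2
    have hq := hpos (fun i : Fin (l + 1) => ψ i.succ) fun i => h0 i.succ
    obtain ⟨⟨t, ht, hEt⟩, -⟩ := hE.directSum (ψ 0)
      (PartiteVec.bigSum fun i : Fin (l + 1) => ψ i.succ) (h0 0) (hne _ fun i => h0 i.succ)
    rw [← hEt, Fin.sum_univ_succ (fun i => ‖(ψ i).vec‖ ^ 2), ha1]
    have h1 := mul_le_mul_of_nonneg_left (hm 0) ht.1
    have h2 := mul_le_mul_of_nonneg_left (ih (fun i => ψ i.succ) (fun i => h0 i.succ)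
      fun i => hm i.succ) (sub_nonneg.2 ht.2)
    -- The entropy term splits as `1 + a`: the part `a` is used here with the squared norms as
    -- weights, the part `1` in `h4` with the numbers of summands `1` and `l + 1`.
    have h3 := mul_le_mul_of_nonneg_left (mul_logb_add_binEntropy_le ht hq0 hq) ha0
    have hl : (0 : ℝ) < (l : ℝ) + 1 := by positivity
    have h4 := mul_logb_add_binEntropy_le ht one_pos hl
    rw [Real.logb_one, add_comm 1 ((l : ℝ) + 1)] at h4
    push_cast
    nlinarith [h1, h2, h3, h4]

lemma isLogBounded (hE : IsLogSpectralPoint α E) (hk : 1 ≤ k) (hα0 : 0 ≤ α) (hα1 : α < 1) :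
    IsLogBounded fun ψ : UnitPartiteVec k => E ψ.1 := by
  intro l ψ h0 h1
  have hn := norm_sq_bigSum hk ψ
  rw [h1, one_pow] at hn
  -- The empty sum has norm zero, so it cannot be a unit vector.
  obtain _ | l := l
  · simp at hn
  have h := hE.bigSum_le hk hα0 hα1 (⨆ i, E ((ψ i).normalize (h0 i)).1) l ψ h0 fun i => by
    have hpos : 0 < ‖(ψ i).vec‖ := norm_pos_iff.2 (h0 i)
    have hle := le_ciSup (Set.finite_range fun i => E ((ψ i).normalize (h0 i)).1).bddAbove i
    have hs : E ((ψ i).normalize (h0 i)).1 = E (ψ i) + _ :=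
      hE.scale_pos (h0 i) (inv_pos.2 hpos)
    rw [inv_pow, Real.logb_inv] at hs
    linarith
  rw [← hn, Real.logb_one, mul_zero, add_zero] at h
  push_cast
  exact h

end IsLogSpectralPoint

end LOCCSpectrum

end

theorem mainTheorem8 (k : ℕ) (hk : 1 ≤ k) (E : LOCCSpectrum.PartiteVec k → ℝ)
    (hE : E ∈ LOCCSpectrum.logSpectrum k) :
    (fun ψ : LOCCSpectrum.UnitPartiteVec k => E ψ.1) ∈ LOCCSpectrum.subFunctionals k := by
  obtain ⟨α, hα0, hα1, hE⟩ := hE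
  refine ⟨hE.nonneg hk hα0 hα1, fun ψ φ => ?_, hE.isLogBounded hk hα0 hα1,
    hE.isMonotoneOnAverage hk hα0 hα1⟩
  have hne : ∀ ψ : LOCCSpectrum.UnitPartiteVec k, ψ.1.vec ≠ 0 := fun ψ h => by
    have := ψ.2
    rw [h, norm_zero] at this
    exact zero_ne_one this
  exact (hE.additive ψ.1 φ.1 (hne ψ) (hne φ)).le
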